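/- \textbf{Theorem (Both $k$-near Addition).} Let $G=(S\cup Q,E)$ be a bipartite graph with $E\subseteq S\times Q$ between a finite set $S$ of students and a finite set $Q$ of questions, let $n=|S|+|Q|\ge 1$, let $k\ge 1$ be an integer, and let $\alpha:S\to\{1,\dots,|S|\}$ and $\beta:Q\to\{1,\dots,|Q|\}$ be bijections (the initial orderings, students from weakest to strongest, questions from easiest to hardest). A \emph{feasible solution} consists of a set $F\subseteq (S\times Q)\setminus E$ of added edges and bijections $\pi:S\to\{1,\dots,|S|\}$, $\sigma:Q\to\{1,\dots,|Q|\}$ such that \begin{itemize} \item $|\pi(s)-\alpha(s)|\le k$ for all $s\in S$ and $|\sigma(x)-\beta(x)|\le k$ for all $x\in Q$; \item ($\pi$ is nested) $\pi(s_1)\ge\pi(s_2)$ implies $N(s_1)\supseteq N(s_2)$ for all $s_1,s_2\in S$; \item ($\sigma$ has the interval property) for every $s\in S$ there is $j\ge 0$ with $N(s)=\{x\in Q:\sigma(x)\le j\}$, \end{itemize} where $N(s)=\{x\in Q:(s,x)\in E\cup F\}$. The Both $k$-near Addition problem asks, given $(G,k,\alpha,\beta)$, for the minimum of $|F|$ over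 all feasible solutions and for a feasible solution $(F,\pi,\sigma)$ attaining it. There are an algorithm (a single program for a unit-cost random access machine with addition, truncated subtraction and comparison of natural numbers, receiving $k$, $|S|$, $|Q|$, $\alpha$, $\beta$ and the adjacency matrix of $G$ in its memory) and an absolute constant $C$ such that, for all such inputs, the algorithm solves the Both $k$-near Addition problem in at most $C\,n^3k^{4k+4}$ steps. -/

import Mathlib

/-! ### A unit-cost random access machine

Programs are finite structured programs over natural-number registers `x₀, x₁, …` and
one-dimensional random-access arrays `A₀, A₁, …` of natural numbers.  The only arithmetic is
addition, (truncated) subtraction and comparison.  A fixed program mentions finitely many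
registers and arrays, and runs on inputs of every size. -/

namespace RAM

/-- Expressions. `arr a e` reads the cell of the array `a` whose address is the value of `e`. -/
inductive Exp : Type
  | const (c : ℕ)
  | var (x : ℕ)
  | arr (a : ℕ) (e : Exp)
  | add (e₁ e₂ : Exp)
  | sub (e₁ e₂ : Exp)
  | lt (e₁ e₂ : Exp)
  | eq (e₁ e₂ : Exp)

/-- Structured programs. -/
inductive Cmd : Type
  | skip
  | assign (x : ℕ) (e : Exp)
  | store (a : ℕ) (i e : Exp)
  | seq (c₁ c₂ : Cmd)
  | ite (b : Exp) (c₁ c₂ : Cmd)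
  | while (b : Exp) (c : Cmd)

/-- The contents of all registers and all arrays. -/
structure Mem where
  var : ℕ → ℕ
  arr : ℕ → ℕ → ℕ

/-- The value of an expression. Comparisons have value `1` (true) or `0` (false). -/
def Exp.eval (M : Mem) : Exp → ℕ
  | .const c => c
  | .var x => M.var x
  | .arr a e => M.arr a (e.eval M)
  | .add e₁ e₂ => e₁.eval M + e₂.eval M
  | .sub e₁ e₂ => e₁.eval M - e₂.eval M
  | .lt e₁ e₂ => if e₁.eval M < e₂.eval M then 1 else 0
  | .eq e₁ e₂ => if e₁.eval M = e₂.eval M then 1 else 0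

/-- The cost of evaluating an expression: one step for every constant, memory access and
operation in it. -/
def Exp.cost : Exp → ℕ
  | .const _ => 1
  | .var _ => 1
  | .arr _ e => e.cost + 1
  | .add e₁ e₂ => e₁.cost + e₂.cost + 1
  | .sub e₁ e₂ => e₁.cost + e₂.cost + 1
  | .lt e₁ e₂ => e₁.cost + e₂.cost + 1
  | .eq e₁ e₂ => e₁.cost + e₂.cost + 1

/-- Write the value `v` into the register `x`. -/
def Mem.setVar (M : Mem) (x v : ℕ) : Mem :=
  { M with var := Function.update M.var x v }

/-- Write the value `v` into the cell `i` of the array `a`. -/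
def Mem.setArr (M : Mem) (a i v : ℕ) : Mem :=
  { M with arr := Function.update M.arr a (Function.update (M.arr a) i v) }

/-- `Runs c M t M'`: started on the memory `M`, the program `c` halts after exactly `t` steps
with the memory `M'`. A condition is true when its value is nonzero. -/
inductive Runs : Cmd → Mem → ℕ → Mem → Prop
  | skip (M : Mem) : Runs .skip M 1 M
  | assign (x : ℕ) (e : Exp) (M : Mem) :
      Runs (.assign x e) M (e.cost + 1) (M.setVar x (e.eval M))
  | store (a : ℕ) (i e : Exp) (M : Mem) :
      Runs (.store a i e) M (i.cost + e.cost + 1) (M.setArr a (i.eval M) (e.eval M))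
  | seq {c₁ c₂ : Cmd} {M₁ M₂ M₃ : Mem} {t₁ t₂ : ℕ} :
      Runs c₁ M₁ t₁ M₂ → Runs c₂ M₂ t₂ M₃ → Runs (.seq c₁ c₂) M₁ (t₁ + t₂) M₃
  | ite_true {b : Exp} {c₁ c₂ : Cmd} {M M' : Mem} {t : ℕ} :
      b.eval M ≠ 0 → Runs c₁ M t M' → Runs (.ite b c₁ c₂) M (b.cost + 1 + t) M'
  | ite_false {b : Exp} {c₁ c₂ : Cmd} {M M' : Mem} {t : ℕ} :
      b.eval M = 0 → Runs c₂ M t M' → Runs (.ite b c₁ c₂) M (b.cost + 1 + t) M'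
  | while_true {b : Exp} {c : Cmd} {M₁ M₂ M₃ : Mem} {t₁ t₂ : ℕ} :
      b.eval M₁ ≠ 0 → Runs c M₁ t₁ M₂ → Runs (.while b c) M₂ t₂ M₃ →
        Runs (.while b c) M₁ (b.cost + 1 + t₁ + t₂) M₃
  | while_false {b : Exp} {c : Cmd} {M : Mem} :
      b.eval M = 0 → Runs (.while b c) M (b.cost + 1) M

end RAM

/-! ### Both `k`-near Chain Addition -/

namespace ChainAddition

/-- An instance with students `Fin m` and questions `Fin q`: the edges of the bipartite graph,
the bound `k`, and the initial orderings of the students and of the questions. An ordering sends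
a vertex to its position; positions are counted from `0`, from the weakest to the strongest
student and from the easiest to the hardest question. -/
structure Input where
  m : ℕ
  q : ℕ
  k : ℕ
  edges : Finset (Fin m × Fin q)
  α : Equiv.Perm (Fin m)
  β : Equiv.Perm (Fin q)

/-- The number of vertices. -/
def Input.n (I : Input) : ℕ := I.m + I.q

/-- The neighborhood of the student `s` in the bipartite graph with edge set `E`. -/
def nbhd {m q : ℕ} (E : Finset (Fin m × Fin q)) (s : Fin m) : Set (Fin q) :=
  {t | (s, t) ∈ E}

/-- The ordering `π` of the students is nested. -/
def Nested {m q : ℕ} (E : Finset (Fin m × Fin q)) (π : Equiv.Perm (Fin m)) : Prop :=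
  ∀ s₁ s₂ : Fin m, π s₂ ≤ π s₁ → nbhd E s₂ ⊆ nbhd E s₁

/-- The ordering `σ` of the questions has the interval property: the neighborhood of each student
consists of the questions in the first `j` positions, for some `j` (possibly `0`). -/
def Interval {m q : ℕ} (E : Finset (Fin m × Fin q)) (σ : Equiv.Perm (Fin q)) : Prop :=
  ∀ s : Fin m, ∃ j : ℕ, nbhd E s = {t | (σ t : ℕ) < j}

/-- Every element has a position under `π` in `[α x - k, α x + k]`. -/
def Near {r : ℕ} (k : ℕ) (α π : Equiv.Perm (Fin r)) : Prop :=
  ∀ x : Fin r, (α x : ℤ) - k ≤ (π x : ℤ) ∧ (π x : ℤ) ≤ (α x : ℤ) + k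

/-- Adding the set `F` of new edges to the graph of `I` makes the `k`-near student ordering `π`
nested and gives the `k`-near question ordering `σ` the interval property. -/
def Feasible (I : Input) (F : Finset (Fin I.m × Fin I.q)) (π : Equiv.Perm (Fin I.m))
    (σ : Equiv.Perm (Fin I.q)) : Prop :=
  Disjoint I.edges F ∧ Near I.k I.α π ∧ Near I.k I.β σ ∧
    Nested (I.edges ∪ F) π ∧ Interval (I.edges ∪ F) σ

/-- The numbers of edge additions with which a feasible solution exists. -/
def costs (I : Input) : Set ℕ :=
  {c | ∃ F π σ, Feasible I F π σ ∧ F.card = c}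

/-- The initial memory: registers `0, 1, 2` hold `k`, the number of students and the number of
questions; arrays `0, 1` hold the initial orderings and array `2` the adjacency matrix, row by
row. All other cells are `0`. -/
def Input.mem (I : Input) : RAM.Mem where
  var := fun x => if x = 0 then I.k else if x = 1 then I.m else if x = 2 then I.q else 0
  arr := fun a i =>
    if a = 0 then (if h : i < I.m then (I.α ⟨i, h⟩ : ℕ) else 0)
    else if a = 1 then (if h : i < I.q then (I.β ⟨i, h⟩ : ℕ) else 0)
    else if a = 2 then (if ∃ e ∈ I.edges, i = (e.1 : ℕ) * I.q + (e.2 : ℕ) then 1 else 0)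
    else 0

/-- The final memory `M` shows a solution: register `3` holds the number of added edges, arrays
`3, 4` the orderings, and array `5` the matrix of the set of added edges, row by row. -/
def Shows (I : Input) (M : RAM.Mem) (F : Finset (Fin I.m × Fin I.q))
    (π : Equiv.Perm (Fin I.m)) (σ : Equiv.Perm (Fin I.q)) : Prop :=
  M.var 3 = F.card ∧
    (∀ s : Fin I.m, M.arr 3 s = (π s : ℕ)) ∧
    (∀ t : Fin I.q, M.arr 4 t = (σ t : ℕ)) ∧
    ∀ (s : Fin I.m) (t : Fin I.q),
      M.arr 5 ((s : ℕ) * I.q + (t : ℕ)) = if (s, t) ∈ F then 1 else 0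

/-- The final memory `M` holds the minimum number of edge additions, together with a feasible
solution that attains it. -/
def Solved (I : Input) (M : RAM.Mem) : Prop :=
  IsLeast (costs I) (M.var 3) ∧ ∃ F π σ, Feasible I F π σ ∧ Shows I M F π σ

end ChainAddition

/-!
# Both `k`-near Addition by dynamic programming over pairs of masks

Place the students one after the other from the weakest to the strongest, and, interleaved with
them, the questions from the easiest to the hardest; a student is placed as soon as the first `j`
questions are there, where `j` is the degree that the student ends up with. A solution of the
problem is the same as such an interleaving in which every student finds all of his or her old
neighbors among the questions already placed (`Chain`, `Feasible.chain`, `Chain.feasible`), and the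
sum of the degrees exceeds the number of added edges by the constant `|E|`. So a cheapest path has
to be found in the space of the pairs (set of placed students, set of placed questions).

As the orderings are `k`-near, the set of the first `i` elements contains every element whose
initial position is below `i - k` and none whose initial position is `i + k` or more. With all
positions shifted by `k`, it is described by `i` and by a mask of `2k` bits, for the shifted
positions `i, …, i + 2k - 1` (`InSet`); below `i` everything counts as placed. The shifted positions
below `k` belong to no element and count as placed from the start. Placing the element
at the shifted position `i + b`, with `b ≤ 2k`, turns the mask `U` into `(U + 2 ^ b) / 2`
(`inSet_next`). This never fails to record a placed element. If an element leaves the window without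
having been placed, it can never be placed later, so such a path does not reach a final state, since
`r` different ones among `r` elements have to be placed (`NearSeq.surj`). Hence the program need not
test for it.

There are `(m + 1) (q + 1) 16 ^ k` states. The program stores for each of them the cost to go and a
best move (`Bellman`, `fillC_spec`), in the order of decreasing addresses, all moves leading to
larger addresses (`State.Valid.idx_lt_next`). Every solution is a path, so the cost to go from the
initial state is at most its cost (`Chain.le_cost`). Conversely, following the best moves gives a
solution of exactly that cost (`Traced`, `traceC_spec`). In place of infinity the tables use
`m q + 1`, which exceeds the cost `m q` of adding all missing edges (`Done.root_lt`).

A move is tested in `O(n 4 ^ k)` steps, so the time is `O(n ^ 3 64 ^ k k)`, even though all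
multiplications and divisions are done by repeated additions and subtractions, and `64 ^ k` is at
most `4096 k ^ (4 k)` (`time_le`).

The correctness of the programs is shown with Hoare triples `HT` for total correctness that carry a
time bound. That a program leaves other registers and arrays alone is read off its syntax (`Frame`).
-/

namespace RAM

/-! ### Total correctness with time bounds -/

attribute [simp] Exp.cost

@[simp] theorem Exp.eval_const (M : Mem) (c : ℕ) : (Exp.const c).eval M = c := rfl

@[simp] theorem Exp.eval_var (M : Mem) (x : ℕ) : (Exp.var x).eval M = M.var x := rfl

@[simp] theorem Exp.eval_arr (M : Mem) (a : ℕ) (e : Exp) :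
    (Exp.arr a e).eval M = M.arr a (e.eval M) := rfl

@[simp] theorem Exp.eval_add (M : Mem) (e₁ e₂ : Exp) :
    (Exp.add e₁ e₂).eval M = e₁.eval M + e₂.eval M := rfl

@[simp] theorem Exp.eval_sub (M : Mem) (e₁ e₂ : Exp) :
    (Exp.sub e₁ e₂).eval M = e₁.eval M - e₂.eval M := rfl

/-- Comparisons are used only as conditions, so it suffices to know when they fail. -/
@[simp] theorem Exp.eval_lt_eq_zero (M : Mem) (e₁ e₂ : Exp) :
    (Exp.lt e₁ e₂).eval M = 0 ↔ ¬ e₁.eval M < e₂.eval M := by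
  simp [Exp.eval]

@[simp] theorem Exp.eval_eq_eq_zero (M : Mem) (e₁ e₂ : Exp) :
    (Exp.eq e₁ e₂).eval M = 0 ↔ ¬ e₁.eval M = e₂.eval M := by
  rw [Exp.eval]
  split_ifs <;> simp [*]

@[simp] theorem Mem.setVar_var (M : Mem) (x v y : ℕ) :
    (M.setVar x v).var y = if y = x then v else M.var y := by
  simp [Mem.setVar, Function.update_apply]

@[simp] theorem Mem.setVar_arr (M : Mem) (x v : ℕ) : (M.setVar x v).arr = M.arr := rfl

@[simp] theorem Mem.setArr_var (M : Mem) (a i v : ℕ) : (M.setArr a i v).var = M.var := rfl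

@[simp] theorem Mem.setArr_arr (M : Mem) (a i v b : ℕ) :
    (M.setArr a i v).arr b = if b = a then Function.update (M.arr a) i v else M.arr b := by
  simp [Mem.setArr, Function.update_apply]

/-- The registers that a program may write. -/
def Cmd.vars : Cmd → List ℕ
  | .skip => []
  | .assign x _ => [x]
  | .store _ _ _ => []
  | .seq c₁ c₂ => c₁.vars ++ c₂.vars
  | .ite _ c₁ c₂ => c₁.vars ++ c₂.vars
  | .while _ c => c.vars

/-- The arrays that a program may write. -/
def Cmd.arrs : Cmd → List ℕ
  | .skip => []
  | .assign _ _ => []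
  | .store a _ _ => [a]
  | .seq c₁ c₂ => c₁.arrs ++ c₂.arrs
  | .ite _ c₁ c₂ => c₁.arrs ++ c₂.arrs
  | .while _ c => c.arrs

/-- The memories `M` and `M'` agree on everything that `c` does not write. -/
structure Frame (c : Cmd) (M M' : Mem) : Prop where
  var : ∀ x, x ∉ c.vars → M'.var x = M.var x
  arr : ∀ a, a ∉ c.arrs → M'.arr a = M.arr a

theorem Frame.refl (c : Cmd) (M : Mem) : Frame c M M := ⟨fun _ _ => rfl, fun _ _ => rfl⟩

theorem Frame.trans {c : Cmd} {M₁ M₂ M₃ : Mem} (h : Frame c M₁ M₂) (h' : Frame c M₂ M₃) :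
    Frame c M₁ M₃ :=
  ⟨fun x hx => (h'.var x hx).trans (h.var x hx), fun x hx => (h'.arr x hx).trans (h.arr x hx)⟩

theorem Frame.mono {c c' : Cmd} {M M' : Mem} (h : Frame c M M') (hv : c.vars ⊆ c'.vars)
    (ha : c.arrs ⊆ c'.arrs) : Frame c' M M' :=
  ⟨fun x hx => h.var x fun h' => hx (hv h'), fun x hx => h.arr x fun h' => hx (ha h')⟩

/-- A program changes only what it writes syntactically. -/
theorem Runs.frame {c : Cmd} {M M' : Mem} {t : ℕ} (h : Runs c M t M') : Frame c M M' := by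
  induction h with
  | skip M => exact Frame.refl _ _
  | assign x e M => exact ⟨fun y hy => by simp_all [Cmd.vars], fun _ _ => rfl⟩
  | store a i e M => exact ⟨fun _ _ => rfl, fun b hb => by simp_all [Cmd.arrs]⟩
  | seq _ _ h₁ h₂ =>
    exact (h₁.mono (by simp [Cmd.vars]) (by simp [Cmd.arrs])).trans
      (h₂.mono (by simp [Cmd.vars]) (by simp [Cmd.arrs]))
  | ite_true _ _ h => exact h.mono (by simp [Cmd.vars]) (by simp [Cmd.arrs])
  | ite_false _ _ h => exact h.mono (by simp [Cmd.vars]) (by simp [Cmd.arrs])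
  | while_true _ _ _ h₁ h₂ =>
    exact (h₁.mono (by simp [Cmd.vars]) (by simp [Cmd.arrs])).trans h₂
  | while_false _ => exact Frame.refl _ _

/-- Total correctness with a time bound: started on `M`, the program `c` halts after at most `T`
steps with a memory that satisfies `Q`. -/
def HT (c : Cmd) (M : Mem) (T : ℕ) (Q : Mem → Prop) : Prop :=
  ∃ t M', Runs c M t M' ∧ t ≤ T ∧ Q M'

theorem HT.mono {c : Cmd} {M : Mem} {T T' : ℕ} {Q Q' : Mem → Prop} (h : HT c M T Q)
    (hQ : ∀ M', Frame c M M' → Q M' → Q' M') (hT : T ≤ T') : HT c M T' Q' := by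
  obtain ⟨t, M', hr, ht, hq⟩ := h
  exact ⟨t, M', hr, ht.trans hT, hQ M' hr.frame hq⟩

theorem HT.skip {M : Mem} {Q : Mem → Prop} (h : Q M) : HT .skip M 1 Q :=
  ⟨1, M, .skip M, le_rfl, h⟩

theorem HT.assign {M : Mem} {x : ℕ} {e : Exp} {Q : Mem → Prop} (h : Q (M.setVar x (e.eval M))) :
    HT (.assign x e) M (e.cost + 1) Q :=
  ⟨_, _, .assign x e M, le_rfl, h⟩

theorem HT.store {M : Mem} {a : ℕ} {i e : Exp} {Q : Mem → Prop}
    (h : Q (M.setArr a (i.eval M) (e.eval M))) :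
    HT (.store a i e) M (i.cost + e.cost + 1) Q :=
  ⟨_, _, .store a i e M, le_rfl, h⟩

theorem HT.seq {c₁ c₂ : Cmd} {M : Mem} {T₁ T₂ : ℕ} {R Q : Mem → Prop} (h₁ : HT c₁ M T₁ R)
    (h₂ : ∀ M₁, Frame c₁ M M₁ → R M₁ → HT c₂ M₁ T₂ Q) : HT (.seq c₁ c₂) M (T₁ + T₂) Q := by
  obtain ⟨t, M', hr, ht, hq⟩ := h₁
  obtain ⟨t', M'', hr', ht', hq'⟩ := h₂ M' hr.frame hq
  exact ⟨_, _, .seq hr hr', by omega, hq'⟩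

theorem HT.assign_seq {c : Cmd} {M : Mem} {x T : ℕ} {e : Exp} {Q : Mem → Prop}
    (h : HT c (M.setVar x (e.eval M)) T Q) : HT (.seq (.assign x e) c) M (e.cost + 1 + T) Q := by
  obtain ⟨t, M', hr, ht, hq⟩ := h
  exact ⟨_, _, .seq (.assign x e M) hr, by omega, hq⟩

theorem HT.store_seq {c : Cmd} {M : Mem} {a T : ℕ} {i e : Exp} {Q : Mem → Prop}
    (h : HT c (M.setArr a (i.eval M) (e.eval M)) T Q) :
    HT (.seq (.store a i e) c) M (i.cost + e.cost + 1 + T) Q := by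
  obtain ⟨t, M', hr, ht, hq⟩ := h
  exact ⟨_, _, .seq (.store a i e M) hr, by omega, hq⟩

/-- The bound is the sum of those of the two branches: constant factors do not matter here. -/
theorem HT.ite {b : Exp} {c₁ c₂ : Cmd} {M : Mem} {T₁ T₂ : ℕ} {Q : Mem → Prop}
    (h₁ : b.eval M ≠ 0 → HT c₁ M T₁ Q) (h₂ : b.eval M = 0 → HT c₂ M T₂ Q) :
    HT (.ite b c₁ c₂) M (b.cost + 1 + (T₁ + T₂)) Q := by
  by_cases hb : b.eval M = 0
  · obtain ⟨t, M', hr, ht, hq⟩ := h₂ hb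
    exact ⟨_, _, .ite_false hb hr, by omega, hq⟩
  · obtain ⟨t, M', hr, ht, hq⟩ := h₁ hb
    exact ⟨_, _, .ite_true hb hr, by omega, hq⟩

/-- A counting loop: `c` is run with the register `x` equal to `e - 1`, …, `1`, `0`. Counting down
needs no register for the number of rounds. -/
def Cmd.loop (x : ℕ) (e : Exp) (c : Cmd) : Cmd :=
  .seq (.assign x e) (.while (.var x) (.seq (.assign x (.sub (.var x) (.const 1))) c))

/-- The rule for counting loops: `Inv n` holds when `n` rounds are left. The body may not write the
counter, and the invariant may not mention it. -/
theorem HT.loop {x : ℕ} {e : Exp} {c : Cmd} {M : Mem} {T : ℕ} (Inv : ℕ → Mem → Prop)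
    (hx : ∀ n M v, Inv n M → Inv n (M.setVar x v)) (hxc : x ∉ c.vars)
    (h0 : Inv (e.eval M) M)
    (hc : ∀ i < e.eval M, ∀ M₁, Frame (Cmd.loop x e c) M M₁ → M₁.var x = i → Inv (i + 1) M₁ →
      HT c M₁ T (Inv i)) :
    HT (Cmd.loop x e c) M (e.cost + 3 + e.eval M * (T + 6)) (Inv 0) := by
  have key : ∀ n ≤ e.eval M, ∀ M₁, Frame (Cmd.loop x e c) M M₁ → M₁.var x = n → Inv n M₁ →
      HT (.while (.var x) (.seq (.assign x (.sub (.var x) (.const 1))) c)) M₁ (2 + n * (T + 6))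
        (Inv 0) := by
    intro n
    induction n with
    | zero =>
      intro _ M₁ _ h2 h3
      exact ⟨_, _, .while_false h2, by simp, h3⟩
    | succ n ih =>
      intro hn M₁ hF h2 h3
      have hF1 : Frame (Cmd.loop x e c) M (M₁.setVar x n) :=
        hF.trans ⟨fun y hy => by
          have : y ≠ x := by rintro rfl; simp [Cmd.loop, Cmd.vars] at hy
          simp [this], fun _ _ => rfl⟩
      obtain ⟨t, M₂, hr, ht, hq⟩ := hc n (by omega) (M₁.setVar x n) hF1 (by simp) (hx _ _ _ h3)
      have hF2 : Frame (Cmd.loop x e c) M M₂ :=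
        hF1.trans (hr.frame.mono (by simp [Cmd.loop, Cmd.vars]) (by simp [Cmd.loop, Cmd.arrs]))
      obtain ⟨t', M₃, hr', ht', hq'⟩ := ih (by omega) M₂ hF2
        (by rw [hr.frame.var x hxc]; simp) hq
      refine ⟨_, M₃, .while_true (M₂ := M₂) (t₁ := 4 + t) (by simp [h2]) ?_ hr', ?_, hq'⟩
      · refine .seq (t₁ := 4) (M₂ := M₁.setVar x n) ?_ hr
        have := Runs.assign x (.sub (.var x) (.const 1)) M₁
        simpa [h2] using this
      · simp only [Exp.cost]
        rw [add_one_mul]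
        omega
  refine (HT.assign_seq (key _ le_rfl _ ?_ (by simp) (hx _ _ _ h0))).mono (fun _ _ h => h)
    (by omega)
  exact ⟨fun y hy => by
    have : y ≠ x := by rintro rfl; simp [Cmd.loop, Cmd.vars] at hy
    simp [this], fun _ _ => rfl⟩

/-! ### Registers and arrays -/

/-! The registers `0`, `1`, `2` hold `k`, `m`, `q`, and `3` counts the added edges. The registers
with a name hold constants, the current state and move, and results of subroutines; the remaining
ones are local to subroutines or pass arguments to them.

The arrays `0`, `1`, `2` hold the input, and `3`, `4`, `5` the output. The arrays `6`, `7`, `8` are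
the tables of the costs to go, of the kinds of the best moves and of their offsets `b`; the array `9`
holds the final degrees of the students. -/

notation "r_W" => (4 : ℕ)
notation "r_big" => (5 : ℕ)
notation "r_i" => (10 : ℕ)
notation "r_U" => (11 : ℕ)
notation "r_j" => (12 : ℕ)
notation "r_V" => (13 : ℕ)
notation "r_kind" => (14 : ℕ)
notation "r_b" => (15 : ℕ)
notation "r_p" => (35 : ℕ)
notation "r_rem" => (40 : ℕ)
notation "r_quot" => (42 : ℕ)
notation "r_prod" => (52 : ℕ)
notation "r_mem" => (33 : ℕ)
notation "r_ok" => (60 : ℕ)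
notation "r_elem" => (61 : ℕ)
notation "r_iNew" => (62 : ℕ)
notation "r_UNew" => (63 : ℕ)
notation "r_jNew" => (64 : ℕ)
notation "r_VNew" => (65 : ℕ)
notation "r_cost" => (66 : ℕ)
notation "r_idx" => (74 : ℕ)
notation "r_best" => (80 : ℕ)
notation "r_bestKind" => (81 : ℕ)
notation "r_bestB" => (82 : ℕ)

/-! ### Arithmetic subroutines -/

infixr:60 " ;; " => Cmd.seq

/-- Division by repeated subtraction; the quotient is left in `r_quot`, the remainder in
`r_rem`. -/
def divC (e₁ e₂ : Exp) : Cmd :=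
  .assign 41 e₂ ;; .assign r_rem e₁ ;; .assign r_quot (.const 0) ;;
    .loop 43 (.var r_rem) (.ite (.lt (.var r_rem) (.var 41)) .skip
      (.assign r_rem (.sub (.var r_rem) (.var 41)) ;;
        .assign r_quot (.add (.var r_quot) (.const 1))))

theorem divC_spec {e₁ e₂ : Exp} {M : Mem} (h1 : e₁.eval (M.setVar 41 (e₂.eval M)) = e₁.eval M)
    (hd : 0 < e₂.eval M) :
    HT (divC e₁ e₂) M (e₁.cost + e₂.cost + 9 + e₁.eval M * 20)
      (fun M' => M'.var r_quot = e₁.eval M / e₂.eval M ∧ M'.var r_rem = e₁.eval M % e₂.eval M) := by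
  set z := e₁.eval M with hz
  set d := e₂.eval M with hd'
  refine (HT.assign_seq (HT.assign_seq (HT.assign_seq (HT.loop (T := 14)
    (fun n M' => M'.var r_quot * d + M'.var r_rem = z ∧ (M'.var r_rem < d ∨ M'.var r_rem ≤ n))
    ?_ (by decide) ?_ ?_)))).mono ?_ ?_
  · intro n M v h; simpa using h
  · simp [h1, ← hd']
  · intro i _ M₁ hF _ ⟨ha, hb⟩
    have h41 : M₁.var 41 = d := by rw [hF.var 41 (by decide)]; simp [← hd']
    refine (HT.ite (T₁ := 1) (T₂ := 8) (fun h => HT.skip ?_) fun h => ?_).mono (fun _ _ h => h)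
      (by simp)
    · simp [h41] at h
      exact ⟨ha, Or.inl h⟩
    · refine (HT.assign_seq (HT.assign ?_)).mono (fun _ _ h => h) (by simp)
      simp [h41] at h ⊢
      rw [add_one_mul]
      omega
  · rintro M' - ⟨ha, hb⟩
    -- No rounds are left; as `d` is positive, the remainder is below `d` in both cases.
    have hb : M'.var r_rem < d := by omega
    rw [← ha]
    constructor
    · rw [Nat.add_comm, Nat.add_mul_div_right _ _ hd, Nat.div_eq_of_lt hb, zero_add]
    · rw [Nat.add_comm, Nat.add_mul_mod_self_right, Nat.mod_eq_of_lt hb]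
  · simp [h1, ← hd']
    omega

/-- Powers of two by repeated doubling; the result is left in `r_p`. -/
def powC (e : Exp) : Cmd :=
  .assign 34 e ;; .assign r_p (.const 1) ;;
    .loop 36 (.var 34) (.assign r_p (.add (.var r_p) (.var r_p)))

theorem powC_spec {e : Exp} {M : Mem} :
    HT (powC e) M (e.cost + 7 + e.eval M * 10) (fun M' => M'.var r_p = 2 ^ e.eval M) := by
  refine (HT.assign_seq (HT.assign_seq (HT.loop (T := 4)
    (fun n M' => M'.var r_p * 2 ^ n = 2 ^ e.eval M) ?_ (by decide) ?_ ?_))).mono ?_ ?_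
  · intro n M v h; simpa using h
  · simp
  · intro i _ M₁ hF _ h
    refine HT.assign ?_
    simp [← h, pow_succ]
    ring
  · rintro M' - h
    simpa using h
  · simp
    omega

/-- Multiplication by repeated addition; the product is left in `r_prod`. -/
def mulC (e₁ e₂ : Exp) : Cmd :=
  .assign 50 e₁ ;; .assign r_prod (.const 0) ;;
    .loop 53 e₂ (.assign r_prod (.add (.var r_prod) (.var 50)))

theorem mulC_spec {e₁ e₂ : Exp} {M : Mem}
    (h : ∀ v, e₂.eval ((M.setVar 50 v).setVar r_prod 0) = e₂.eval M) :
    HT (mulC e₁ e₂) M (e₁.cost + e₂.cost + 6 + e₂.eval M * 10)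
      (fun M' => M'.var r_prod = e₁.eval M * e₂.eval M) := by
  refine (HT.assign_seq (HT.assign_seq (HT.loop (T := 4)
    (fun n M' => M'.var r_prod + e₁.eval M * n = e₁.eval M * e₂.eval M) ?_ (by decide) ?_ ?_))).mono
      ?_ ?_
  · intro n M v h; simpa using h
  · simp [h]
  · intro i _ M₁ hF _ h1
    have h50 : M₁.var 50 = e₁.eval M := by rw [hF.var 50 (by simp [Cmd.loop, Cmd.vars])]; simp
    refine HT.assign ?_
    simp [← h1, h50]
    ring
  · rintro M' - h
    simpa using h
  · simp [h]
    omega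

end RAM

namespace ChainAddition

open RAM

/-! ### Sets encoded by masks, and the moves of the dynamic program -/

/-- The set of shifted positions that the pair `(i, U)` encodes: everything below `i`, and `i + b`
for every bit `b ≤ 2k` of the mask `U`. The element with initial position `p` has the shifted
position `p + k`. -/
def InSet (k i U P : ℕ) : Prop := P < i ∨ (P ≤ i + 2 * k ∧ U.testBit (P - i))

/-- Membership of the value of `e` in the set encoded by the registers `20` and `21`; the result is
left in `r_mem`. -/
def memC (e : Exp) : Cmd :=
  .assign 30 e ;;
  .ite (.lt (.var 30) (.var 20)) (.assign r_mem (.const 1))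
    (.ite (.lt (.add (.var 20) (.add (.var 0) (.var 0))) (.var 30)) (.assign r_mem (.const 0))
      (powC (.sub (.var 30) (.var 20)) ;; divC (.var 21) (.var r_p) ;;
        divC (.var r_quot) (.const 2) ;; .assign r_mem (.var r_rem)))

theorem memC_spec {e : Exp} {M : Mem} {W : ℕ} (hW : M.var 21 ≤ W) :
    HT (memC e) M (e.cost + 70 + 20 * M.var 0 + 40 * W)
      (fun M' => M'.var r_mem = 0 ↔ ¬ InSet (M.var 0) (M.var 20) (M.var 21) (e.eval M)) := by
  refine (HT.assign_seq (HT.ite (T₁ := 2) (fun h => HT.assign ?_) fun h =>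
    HT.ite (T₁ := 2) (T₂ := 40 + 20 * M.var 0 + 40 * W)
      (fun h' => HT.assign ?_) fun h' => ?_)).mono (fun _ _ h => h) ?_
  · simp at h
    simp [InSet, h]
  · simp at h h'
    have : ¬ InSet (M.var 0) (M.var 20) (M.var 21) (e.eval M) := by
      unfold InSet; omega
    simp [this]
  · simp at h h'
    set P := e.eval M
    have hb : P - M.var 20 ≤ 2 * M.var 0 := by omega
    refine (HT.seq powC_spec (T₂ := 30 + 40 * W) fun M₁ hF₁ h1 => ?_).mono (fun _ _ h => h) ?_
    · simp at h1
      have e21 : M₁.var 21 = M.var 21 := by rw [hF₁.var 21 (by decide)]; simp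
      refine (HT.seq (divC_spec (by simp) ?_) (T₂ := 19 + 20 * W) fun M₂ hF₂ h2 => ?_).mono
        (fun _ _ h => h) ?_
      · simp [h1]
      · simp [e21, h1] at h2
        refine (HT.seq (divC_spec (by simp) ?_) (T₂ := 2) fun M₃ hF₃ h3 => HT.assign ?_).mono
          (fun _ _ h => h) ?_
        · simp
        · -- The bit is the parity of the quotient by the power of two.
          simp [h2.1] at h3
          have : InSet (M.var 0) (M.var 20) (M.var 21) P ↔
              M.var 21 / 2 ^ (P - M.var 20) % 2 = 1 := by
            rw [InSet, Nat.testBit_eq_decide_div_mod_eq, decide_eq_true_iff]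
            constructor
            · rintro (h | h) <;> [omega; exact h.2]
            · intro h; exact Or.inr ⟨by omega, h⟩
          simp [h3.2, this]
        · simp [h2.1]
          have := Nat.div_le_self (M.var 21) (2 ^ (P - M.var 20))
          omega
      · simp [e21]
        omega
    · simp
      omega
  · simp
    omega

/-- In the set encoded by `(i, U)`, the element `e` at the shifted position `i + b` is free, so it
may be placed next. There are `r` elements, and `A` holds their initial positions. The condition
`i + b < r + k` is implied by the existence of `e`. -/
def CanPick (k r : ℕ) (A : ℕ → ℕ) (i U b e : ℕ) : Prop :=
  i < r ∧ e < r ∧ A e + k = i + b ∧ ¬ InSet k i U (i + b)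

/-- Decides which element of the array `a` can be picked; `24` is the answer, `25` the element and
`26` the mask after the pick. -/
def pickC (a : ℕ) : Cmd :=
  .assign 24 (.const 0) ;;
  memC (.add (.var 20) (.var 23)) ;;
  .ite (.eq (.var r_mem) (.const 0))
    (.ite (.lt (.var 20) (.var 22))
      (.loop 27 (.var 22)
        (.ite (.eq (.add (.arr a (.var 27)) (.var 0)) (.add (.var 20) (.var 23)))
          (.assign 24 (.const 1) ;; .assign 25 (.var 27)) .skip))
      .skip)
    .skip ;;
  powC (.var 23) ;; divC (.add (.var 21) (.var r_p)) (.const 2) ;; .assign 26 (.var r_quot)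

theorem pickC_spec {a : ℕ} {M : Mem} {W : ℕ} (hU : M.var 21 ≤ W) (hb : 2 ^ M.var 23 ≤ W) :
    HT (pickC a) M (200 + 20 * M.var 0 + 100 * W + 10 * M.var 23 + 30 * M.var 22)
      (fun M' =>
        ((M'.var 24 = 0 ∧
            ∀ e, ¬ CanPick (M.var 0) (M.var 22) (M.arr a) (M.var 20) (M.var 21) (M.var 23) e) ∨
          (M'.var 24 = 1 ∧ CanPick (M.var 0) (M.var 22) (M.arr a) (M.var 20) (M.var 21) (M.var 23)
            (M'.var 25))) ∧
        M'.var 26 = (M.var 21 + 2 ^ M.var 23) / 2) := by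
  refine (HT.assign_seq (HT.seq (memC_spec (W := W) (by simpa using hU))
    (T₂ := 100 + 40 * W + 10 * M.var 23 + 30 * M.var 22) fun M₁ hF₁ h1 => ?_)).mono
    (fun _ _ h => h) ?_
  swap
  · simp; omega
  have f₁ : ∀ x, x ∉ (24 :: (memC (.const 0)).vars) → M₁.var x = M.var x := fun x hx => by
    rw [hF₁.var x fun h => hx (List.mem_cons_of_mem _ h)]
    have : x ≠ 24 := by rintro rfl; simp at hx
    simp [this]
  have e0 := f₁ 0 (by decide)
  have e20 := f₁ 20 (by decide)
  have e21 := f₁ 21 (by decide)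
  have e22 := f₁ 22 (by decide)
  have e23 := f₁ 23 (by decide)
  have e24 : M₁.var 24 = 0 := by rw [hF₁.var 24 (by decide)]; simp
  have ea : M₁.arr a = M.arr a := by
    rw [hF₁.arr a (by simp [memC, Cmd.arrs, powC, divC, Cmd.loop])]
    simp
  simp at h1
  refine (HT.seq (R := fun M₂ =>
      (M₂.var 24 = 0 ∧
            ∀ e, ¬ CanPick (M.var 0) (M.var 22) (M.arr a) (M.var 20) (M.var 21) (M.var 23) e) ∨
          (M₂.var 24 = 1 ∧ CanPick (M.var 0) (M.var 22) (M.arr a) (M.var 20) (M.var 21) (M.var 23)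
            (M₂.var 25))) (T₁ := 20 + M.var 22 * 30) (T₂ := 70 + 40 * W + 10 * M.var 23)
      ?_ fun M₂ hF₂ h2 => ?_).mono (fun _ _ h => h) ?_
  · refine (HT.ite (T₁ := 14 + M.var 22 * 30) (T₂ := 1) (fun hm => ?_) fun hm => ?_).mono
      (fun _ _ h => h) ?_
    · have hm : M₁.var r_mem = 0 := by by_contra h; simp [h] at hm
      rw [h1] at hm
      refine (HT.ite (T₁ := 4 + M.var 22 * 30) (T₂ := 1) (fun hm' => ?_) fun hm' => ?_).mono
        (fun _ _ h => h) ?_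
      · simp [e20, e22] at hm'
        refine (HT.loop (T := 14) (fun n M₂ =>
          (M₂.var 24 = 0 ∧ ∀ e, n ≤ e → e < M.var 22 → M.arr a e + M.var 0 ≠ M.var 20 + M.var 23) ∨
          (M₂.var 24 = 1 ∧ M₂.var 25 < M.var 22 ∧
            M.arr a (M₂.var 25) + M.var 0 = M.var 20 + M.var 23)) ?_ ?_ ?_ ?_).mono ?_ ?_
        · intro n M v h; simpa using h
        · simp [Cmd.vars]
        · simp [e22, e24]
          intro e h h'; omega
        · intro i hi M₃ hF₃ h3 hI
          simp [e22] at hi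
          have g0 : M₃.var 0 = M.var 0 := by rw [hF₃.var 0 (by simp [Cmd.loop, Cmd.vars]), e0]
          have g20 : M₃.var 20 = M.var 20 := by
            rw [hF₃.var 20 (by simp [Cmd.loop, Cmd.vars]), e20]
          have g23 : M₃.var 23 = M.var 23 := by
            rw [hF₃.var 23 (by simp [Cmd.loop, Cmd.vars]), e23]
          have ga : M₃.arr a = M.arr a := by
            rw [hF₃.arr a (by simp [Cmd.loop, Cmd.arrs]), ea]
          refine (HT.ite (T₁ := 4) (T₂ := 1) (fun hm => HT.assign_seq (HT.assign ?_))
            fun hm => HT.skip ?_).mono (fun _ _ h => h) ?_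
          · right
            simp [ga, g0, g20, g23, h3] at hm ⊢
            exact ⟨hi, hm⟩
          · simp [ga, g0, g20, g23, h3] at hm
            rcases hI with ⟨hI, hI'⟩ | hI
            · refine Or.inl ⟨hI, fun e he he' => ?_⟩
              rcases Nat.eq_or_lt_of_le he with rfl | h
              · exact hm
              · exact hI' e h he'
            · exact Or.inr hI
          · simp
        · rintro M₃ - (⟨h, h'⟩ | ⟨h, h', h''⟩)
          · exact Or.inl ⟨h, fun e he => h' e (by omega) he.2.1 he.2.2.1⟩
          · exact Or.inr ⟨h, hm', h', h'', hm⟩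
        · simp [e22]
          omega
      · simp [e20, e22] at hm'
        refine HT.skip (Or.inl ⟨e24, fun e he => ?_⟩)
        have := he.1
        omega
      · simp; omega
    · have hm : M₁.var r_mem ≠ 0 := by rintro h; simp [h] at hm
      rw [Ne, h1, not_not] at hm
      exact HT.skip (Or.inl ⟨e24, fun e he => he.2.2.2 hm⟩)
    · simp; omega
  · have g21 : M₂.var 21 = M.var 21 := by
      rw [hF₂.var 21 (by simp [Cmd.loop, Cmd.vars]), e21]
    have g23 : M₂.var 23 = M.var 23 := by
      rw [hF₂.var 23 (by simp [Cmd.loop, Cmd.vars]), e23]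
    refine (HT.seq powC_spec (T₂ := 30 + 40 * W) fun M₃ hF₃ h3 =>
      (HT.seq (divC_spec (by simp) ?_) (T₂ := 2) fun M₄ hF₄ h4 => HT.assign ?_).mono
        (fun _ _ h => h) ?_).mono (fun _ _ h => h) ?_
    · simp
    · have i21 : M₃.var 21 = M.var 21 := by rw [hF₃.var 21 (by decide), g21]
      simp [g23] at h3
      simp [h3, i21] at h4
      have i24 : M₄.var 24 = M₂.var 24 := by
        rw [hF₄.var 24 (by decide), hF₃.var 24 (by decide)]
      have i25 : M₄.var 25 = M₂.var 25 := by
        rw [hF₄.var 25 (by decide), hF₃.var 25 (by decide)]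
      simp [h4.1]
      rw [i24, i25]
      exact h2
    · have i21 : M₃.var 21 = M.var 21 := by rw [hF₃.var 21 (by decide), g21]
      simp [g23] at h3
      simp [h3, i21]
      omega
    · simp [g23]
      omega
  · omega

/-- A state of the dynamic program: `i` students and `j` questions have been placed, and the masks
`U` and `V` tell which ones. -/
structure State where
  i : ℕ
  U : ℕ
  j : ℕ
  V : ℕ

/-- All neighbors of the student `e` are among the placed questions. -/
def Fits (I : Input) (s : State) (e : ℕ) : Prop :=
  ∀ t < I.q, I.mem.arr 2 (e * I.q + t) ≠ 0 → InSet I.k s.j s.V (I.mem.arr 1 t + I.k)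

/-- In the state `s` one may place `e` with offset `b`; `e` is a student if `κ = 0` and a question
otherwise. -/
def Legal (I : Input) (κ b : ℕ) (s : State) (e : ℕ) : Prop :=
  if κ = 0 then CanPick I.k I.m (I.mem.arr 0) s.i s.U b e ∧ Fits I s e
  else CanPick I.k I.q (I.mem.arr 1) s.j s.V b e

/-- The state after a move. -/
def State.next (κ b : ℕ) (s : State) : State :=
  if κ = 0 then ⟨s.i + 1, (s.U + 2 ^ b) / 2, s.j, s.V⟩ else ⟨s.i, s.U, s.j + 1, (s.V + 2 ^ b) / 2⟩

/-- The cost of a move: a student who is placed after `j` questions has degree `j` in the end. -/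
def State.cost (κ : ℕ) (s : State) : ℕ := if κ = 0 then s.j else 0

/-- The memory holds the input and the two constants that the program computes from it. -/
structure Loaded (I : Input) (M : Mem) : Prop where
  k : M.var 0 = I.k
  m : M.var 1 = I.m
  q : M.var 2 = I.q
  W : M.var r_W = 4 ^ I.k
  big : M.var r_big = I.m * I.q + 1
  arr0 : M.arr 0 = I.mem.arr 0
  arr1 : M.arr 1 = I.mem.arr 1
  arr2 : M.arr 2 = I.mem.arr 2

theorem Loaded.frame {I : Input} {M M' : Mem} {c : Cmd} (h : Loaded I M) (hF : Frame c M M')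
    (hc : (∀ x ∈ [0, 1, 2, r_W, r_big], x ∉ c.vars) ∧ ∀ a ∈ [0, 1, 2], a ∉ c.arrs) :
    Loaded I M' where
  k := by rw [hF.var _ (hc.1 _ (by simp)), h.k]
  m := by rw [hF.var _ (hc.1 _ (by simp)), h.m]
  q := by rw [hF.var _ (hc.1 _ (by simp)), h.q]
  W := by rw [hF.var _ (hc.1 _ (by simp)), h.W]
  big := by rw [hF.var _ (hc.1 _ (by simp)), h.big]
  arr0 := by rw [hF.arr _ (hc.2 _ (by simp)), h.arr0]
  arr1 := by rw [hF.arr _ (hc.2 _ (by simp)), h.arr1]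
  arr2 := by rw [hF.arr _ (hc.2 _ (by simp)), h.arr2]

theorem Loaded.setVar {I : Input} {M : Mem} {x v : ℕ} (h : Loaded I M)
    (hx : x ∉ [0, 1, 2, r_W, r_big]) : Loaded I (M.setVar x v) := by
  obtain ⟨h1, h2, h3, h4, h5, h6, h7, h8⟩ := h
  simp only [List.mem_cons, List.not_mem_nil, not_or] at hx
  constructor <;> simp_all <;> omega

/-- Clears the flag `60` if the student `61` has a neighbor outside the set encoded by `20`
and `21`. -/
def fitsC : Cmd :=
  mulC (.var 61) (.var 2) ;; .assign 67 (.var r_prod) ;;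
  .loop 68 (.var 2)
    (.ite (.arr 2 (.add (.var 67) (.var 68)))
      (memC (.add (.arr 1 (.var 68)) (.var 0)) ;;
        .ite (.var r_mem) .skip (.assign 60 (.const 0)))
      .skip)

theorem fitsC_spec {I : Input} {M : Mem} (hM : Loaded I M) (s : State) (h20 : M.var 20 = s.j)
    (h21 : M.var 21 = s.V) (hV : s.V ≤ 4 ^ I.k) (h60 : M.var 60 = 1) :
    HT fitsC M (20 + I.q * (120 + 20 * I.k + 40 * 4 ^ I.k))
      (fun M' => M'.var 60 ≠ 0 ↔ Fits I s (M.var 61)) := by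
  refine (HT.seq (mulC_spec (by simp))
    (T₂ := 6 + I.q * (110 + 20 * I.k + 40 * 4 ^ I.k)) fun M₁ hF₁ h1 =>
      HT.assign_seq (HT.loop (T := 100 + 20 * I.k + 40 * 4 ^ I.k)
        (fun n M₂ => M₂.var 60 ≠ 0 ↔ ∀ t, n ≤ t → t < I.q →
          I.mem.arr 2 (M.var 61 * I.q + t) ≠ 0 → InSet I.k s.j s.V (I.mem.arr 1 t + I.k))
        ?_ (by decide) ?_ ?_) |>.mono ?_ ?_).mono (fun _ _ h => h) ?_
  · intro n M v h; simpa using h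
  · have e2 : M₁.var 2 = I.q := by rw [hF₁.var 2 (by decide), hM.q]
    simp only [Exp.eval, Mem.setVar_var]
    simp [e2]
    rw [hF₁.var 60 (by decide), h60]
    exact ⟨fun _ t h h' => by omega, fun _ => one_ne_zero⟩
  · intro i hi M₂ hF₂ h68 hI
    have hM₁ := hM.frame hF₁ (by decide)
    have hM₂ := (hM₁.setVar (x := 67) (v := M₁.var r_prod) (by decide)).frame hF₂ (by decide)
    have e67 : M₂.var 67 = M.var 61 * I.q := by
      rw [hF₂.var 67 (by decide)]; simpa [hM.q] using h1
    have e20 : M₂.var 20 = s.j := by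
      rw [hF₂.var 20 (by decide)]; simp; rw [hF₁.var 20 (by decide), h20]
    have e21 : M₂.var 21 = s.V := by
      rw [hF₂.var 21 (by decide)]; simp; rw [hF₁.var 21 (by decide), h21]
    simp [hM₁.q] at hi
    refine (HT.ite (T₁ := 90 + 20 * I.k + 40 * 4 ^ I.k) (fun h => ?_)
      fun h => HT.skip ?_).mono (fun _ _ h => h) ?_
    · simp [e67, h68, hM₂.arr2] at h
      refine (HT.seq (memC_spec (W := 4 ^ I.k) (by rw [e21]; exact hV)) (T₂ := 5)
        fun M₃ hF₃ h3 => (HT.ite (fun h' => HT.skip ?_) fun h' => HT.assign ?_).mono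
          (fun _ _ h => h) (by simp)).mono (fun _ _ h => h) ?_
      · simp [h3, hM₂.k, e20, e21, hM₂.arr1, h68] at h'
        rw [hF₃.var 60 (by decide), hI]
        refine ⟨fun hh t ht => ?_, fun hh t ht => hh t (by omega)⟩
        rcases Nat.eq_or_lt_of_le ht with rfl | ht
        · exact fun _ _ => h'
        · exact hh t ht
      · simp [h3, hM₂.k, e20, e21, hM₂.arr1, h68] at h'
        simp only [Exp.eval, Mem.setVar_var, if_true]
        exact ⟨fun hh => absurd rfl hh, fun hh => absurd (hh i le_rfl hi h) h'⟩
      · simp [hM₂.k]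
        omega
    · simp [e67, h68, hM₂.arr2] at h
      rw [hI]
      refine ⟨fun hh t ht => ?_, fun hh t ht => hh t (by omega)⟩
      rcases Nat.eq_or_lt_of_le ht with rfl | ht
      · exact fun _ h' => absurd h h'
      · exact hh t ht
    · simp; omega
  · rintro M₂ - h
    rw [h]
    simp [Fits]
  · have e2 : M₁.var 2 = I.q := by rw [hF₁.var 2 (by decide), hM.q]
    have e2' : (M₁.setVar 67 (M₁.var r_prod)).var 2 = I.q := by simp [e2]
    simp [e2]
    nlinarith
  · simp [hM.q]
    nlinarith

/-- The state held in the registers. -/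
def stateOf (M : Mem) : State := ⟨M.var r_i, M.var r_U, M.var r_j, M.var r_V⟩

/-- Tests the move given by the registers `r_kind` and `r_b` in the current state. Leaves the answer
in `r_ok`, the placed element in `r_elem`, the next state in `r_iNew`, `r_UNew`, `r_jNew`, `r_VNew`,
and the cost in `r_cost`. -/
def tryC : Cmd :=
  .ite (.eq (.var r_kind) (.const 0))
    (.assign 20 (.var r_i) ;; .assign 21 (.var r_U) ;; .assign 22 (.var 1) ;;
      .assign 23 (.var r_b) ;; pickC 0 ;;
      .assign r_ok (.var 24) ;; .assign r_elem (.var 25) ;;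
      .assign r_iNew (.add (.var r_i) (.const 1)) ;; .assign r_UNew (.var 26) ;;
      .assign r_jNew (.var r_j) ;; .assign r_VNew (.var r_V) ;; .assign r_cost (.var r_j) ;;
      .ite (.var r_ok)
        (.assign r_ok (.const 1) ;; .assign 20 (.var r_j) ;; .assign 21 (.var r_V) ;; fitsC) .skip)
    (.assign 20 (.var r_j) ;; .assign 21 (.var r_V) ;; .assign 22 (.var 2) ;;
      .assign 23 (.var r_b) ;; pickC 1 ;;
      .assign r_ok (.var 24) ;; .assign r_elem (.var 25) ;;
      .assign r_iNew (.var r_i) ;; .assign r_UNew (.var r_U) ;;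
      .assign r_jNew (.add (.var r_j) (.const 1)) ;; .assign r_VNew (.var 26) ;;
      .assign r_cost (.const 0))

theorem mem_arr_zero (I : Input) (s : Fin I.m) : I.mem.arr 0 s = (I.α s : ℕ) := by
  simp [Input.mem]

theorem mem_arr_one (I : Input) (t : Fin I.q) : I.mem.arr 1 t = (I.β t : ℕ) := by
  simp [Input.mem]

theorem mem_arr_zero_inj (I : Input) {e e' : ℕ} (h : e < I.m) (h' : e' < I.m)
    (hh : I.mem.arr 0 e = I.mem.arr 0 e') : e = e' := by
  have h1 := mem_arr_zero I ⟨e, h⟩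
  have h2 := mem_arr_zero I ⟨e', h'⟩
  have := I.α.injective (Fin.ext (h1.symm.trans (hh.trans h2)))
  simpa using this

theorem two_pow_le {b k : ℕ} (h : b ≤ 2 * k) : 2 ^ b ≤ 4 ^ k := by
  calc 2 ^ b ≤ 2 ^ (2 * k) := Nat.pow_le_pow_right (by norm_num) h
    _ = 4 ^ k := by rw [pow_mul]; norm_num

theorem le_four_pow (k : ℕ) : k ≤ 4 ^ k := (Nat.lt_pow_self (by norm_num)).le

/-- The unit in which the running time of one move is measured. -/
def Input.unit (I : Input) : ℕ := (I.n + 1) * 4 ^ I.k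

theorem unit_bounds (I : Input) : 4 ^ I.k ≤ I.unit ∧ I.m + I.q + 1 ≤ I.unit ∧
    I.q * 4 ^ I.k ≤ I.unit ∧ I.k ≤ 4 ^ I.k ∧ I.q * I.k ≤ I.q * 4 ^ I.k := by
  have h1 : 1 ≤ 4 ^ I.k := Nat.one_le_pow _ _ (by norm_num)
  refine ⟨?_, ?_, ?_, le_four_pow _, Nat.mul_le_mul_left _ (le_four_pow _)⟩ <;>
    unfold Input.unit Input.n <;> nlinarith

theorem tryC_spec {I : Input} {M : Mem} (hM : Loaded I M) {s : State} (hs : stateOf M = s)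
    (hU : s.U ≤ 4 ^ I.k) (hV : s.V ≤ 4 ^ I.k) (hb : M.var r_b ≤ 2 * I.k) :
    HT tryC M (1100 * I.unit) (fun M' =>
      ((M'.var r_ok = 0 ∧ ∀ e, ¬ Legal I (M.var r_kind) (M.var r_b) s e) ∨
        (M'.var r_ok ≠ 0 ∧ Legal I (M.var r_kind) (M.var r_b) s (M'.var r_elem))) ∧
      (⟨M'.var r_iNew, M'.var r_UNew, M'.var r_jNew, M'.var r_VNew⟩ : State) =
        s.next (M.var r_kind) (M.var r_b) ∧
      M'.var r_cost = s.cost (M.var r_kind)) := by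
  have hs1 : M.var r_i = s.i := by rw [← hs]; rfl
  have hs2 : M.var r_U = s.U := by rw [← hs]; rfl
  have hs3 : M.var r_j = s.j := by rw [← hs]; rfl
  have hs4 : M.var r_V = s.V := by rw [← hs]; rfl
  have h2b := two_pow_le hb
  obtain ⟨u1, u2, u3, u4, u5⟩ := unit_bounds I
  refine (HT.ite
      (T₁ := 300 + 20 * I.k + 100 * 4 ^ I.k + 10 * M.var r_b + 30 * I.m +
        I.q * (120 + 20 * I.k + 40 * 4 ^ I.k))
      (T₂ := 250 + 20 * I.k + 100 * 4 ^ I.k + 10 * M.var r_b + 30 * I.q)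
      (fun hk => ?_) fun hk => ?_).mono (fun _ _ h => h) ?_
  · have hk : M.var r_kind = 0 := by simpa using hk
    refine (HT.assign_seq (HT.assign_seq (HT.assign_seq (HT.assign_seq (HT.seq
      (pickC_spec (W := 4 ^ I.k) ?_ ?_) (T₂ := 56 + I.q * (120 + 20 * I.k + 40 * 4 ^ I.k))
      fun M₁ hF₁ h1 => (HT.assign_seq (HT.assign_seq (HT.assign_seq (HT.assign_seq (HT.assign_seq
        (HT.assign_seq (HT.assign_seq (HT.ite (T₂ := 1)
          (T₁ := 26 + I.q * (120 + 20 * I.k + 40 * 4 ^ I.k)) (fun hp => ?_)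
          fun hp => HT.skip ?_)))))))).mono (fun _ _ h => h) ?_))))).mono (fun _ _ h => h) ?_
    · simp [hs2, hU]
    · simpa using h2b
    · simp [hs1, hs2, hM.k, hM.m, hM.arr0] at h1
      simp at hp
      have hM₁ := ((((hM.setVar (x := 20) (v := s.i) (by decide)).setVar (x := 21) (v := s.U)
        (by decide)).setVar (x := 22) (v := I.m) (by decide)).setVar (x := 23) (v := M.var r_b)
        (by decide)).frame (M' := M₁) (c := pickC 0) (by simpa [hs1, hs2, hM.m] using hF₁)
        (by decide)
      have g1 : M₁.var r_i = s.i := by rw [hF₁.var _ (by decide)]; simp [hs1]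
      have g3 : M₁.var r_j = s.j := by rw [hF₁.var _ (by decide)]; simp [hs3]
      have g4 : M₁.var r_V = s.V := by rw [hF₁.var _ (by decide)]; simp [hs4]
      have hp' : CanPick I.k I.m (I.mem.arr 0) s.i s.U (M.var r_b) (M₁.var 25) := by
        rcases h1.1 with h | h
        · exact absurd h.1 hp
        · exact h.2
      refine (HT.assign_seq (HT.assign_seq (HT.assign_seq ((fitsC_spec (I := I) ?_ s ?_ ?_ hV
        ?_).mono (fun M₂ hF₂ h2 => ?_) le_rfl)))).mono (fun _ _ h => h) ?_
      · repeat first | exact hM₁ | refine Loaded.setVar ?_ (by decide)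
      · simp [g3]
      · simp [g4]
      · simp
      · have e61 : M₂.var r_elem = M₁.var 25 := by rw [hF₂.var _ (by decide)]; simp
        have e62 : M₂.var r_iNew = s.i + 1 := by rw [hF₂.var _ (by decide)]; simp [g1]
        have e63 : M₂.var r_UNew = (s.U + 2 ^ M.var r_b) / 2 := by
          rw [hF₂.var _ (by decide)]; simp [h1.2]
        have e64 : M₂.var r_jNew = s.j := by rw [hF₂.var _ (by decide)]; simp [g3]
        have e65 : M₂.var r_VNew = s.V := by rw [hF₂.var _ (by decide)]; simp [g4]
        have e66 : M₂.var r_cost = s.j := by rw [hF₂.var _ (by decide)]; simp [g3]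
        refine ⟨?_, by simp [State.next, hk, e62, e63, e64, e65], by simp [State.cost, hk, e66]⟩
        simp at h2
        simp only [Legal, hk, if_true, e61]
        by_cases hf : M₂.var r_ok = 0
        · refine Or.inl ⟨hf, fun e he => ?_⟩
          -- Only one student has the given position, so no other one can be legal.
          have : e = M₁.var 25 := mem_arr_zero_inj I he.1.2.1 hp'.2.1 (by
            have := he.1.2.2.1
            have := hp'.2.2.1
            omega)
          exact absurd hf (h2.2 (this ▸ he.2))
        · exact Or.inr ⟨hf, hp', h2.1 hf⟩
      · simp
        omega
    · simp [hs1, hs2, hM.k, hM.m, hM.arr0] at h1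
      simp at hp
      have g1 : M₁.var r_i = s.i := by rw [hF₁.var _ (by decide)]; simp [hs1]
      have g3 : M₁.var r_j = s.j := by rw [hF₁.var _ (by decide)]; simp [hs3]
      have g4 : M₁.var r_V = s.V := by rw [hF₁.var _ (by decide)]; simp [hs4]
      simp [hk, State.next, State.cost, g1, g3, g4, h1.2, hp, Legal]
      rcases h1.1 with h | h
      · exact fun e he => absurd he (h.2 e)
      · omega
    · simp
      omega
    · simp [hM.k, hM.m]
      omega
  · have hk : M.var r_kind ≠ 0 := by simpa using hk
    refine (HT.assign_seq (HT.assign_seq (HT.assign_seq (HT.assign_seq (HT.seq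
      (pickC_spec (W := 4 ^ I.k) ?_ ?_) (T₂ := 30)
      fun M₁ hF₁ h1 => (HT.assign_seq (HT.assign_seq (HT.assign_seq (HT.assign_seq (HT.assign_seq
        (HT.assign_seq (HT.assign ?_))))))).mono (fun _ _ h => h) ?_))))).mono (fun _ _ h => h) ?_
    · simp [hs4, hV]
    · simpa using h2b
    · simp [hs3, hs4, hM.k, hM.q, hM.arr1] at h1
      have g1 : M₁.var r_i = s.i := by rw [hF₁.var _ (by decide)]; simp [hs1]
      have g2 : M₁.var r_U = s.U := by rw [hF₁.var _ (by decide)]; simp [hs2]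
      have g3 : M₁.var r_j = s.j := by rw [hF₁.var _ (by decide)]; simp [hs3]
      simp [hk, State.next, State.cost, g1, g2, g3, h1.2, Legal]
      rcases h1.1 with h | h
      · exact Or.inl h
      · exact Or.inr ⟨by omega, h.2⟩
    · simp
    · simp [hM.k, hM.q]
      omega
  · simp
    nlinarith

/-- The address of the state `s` in the table. -/
def Input.idx (I : Input) (s : State) : ℕ :=
  ((s.i * (I.q + 1) + s.j) * 4 ^ I.k + s.U) * 4 ^ I.k + s.V

/-- Computes the address of the state in the registers `a`, `b`, `c`, `d`. -/
def idxC (a b c d : ℕ) : Cmd :=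
  mulC (.var a) (.add (.var 2) (.const 1)) ;;
  mulC (.add (.var r_prod) (.var c)) (.var r_W) ;;
  mulC (.add (.var r_prod) (.var b)) (.var r_W) ;;
  .assign r_idx (.add (.var r_prod) (.var d))

theorem idxC_spec {I : Input} {M : Mem} (hM : Loaded I M) {a b c d : ℕ}
    (h : ∀ x ∈ [a, b, c, d], x ∉ (idxC 0 0 0 0).vars) :
    HT (idxC a b c d) M (80 * I.unit) (fun M' => M'.var r_idx =
      I.idx ⟨M.var a, M.var b, M.var c, M.var d⟩) := by
  have hv : ∀ x ∈ [a, b, c, d], x ∉ (mulC (.const 0) (.const 0)).vars := fun x hx hx' =>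
    h x hx (by simp [idxC, Cmd.vars]; exact Or.inl hx')
  have hv1 : ∀ e₁ e₂, (mulC e₁ e₂).vars = (mulC (.const 0) (.const 0)).vars := fun _ _ => rfl
  have ha : ∀ e₁ e₂, (mulC e₁ e₂).arrs = [] := fun _ _ => rfl
  obtain ⟨u1, u2, u3, u4, u5⟩ := unit_bounds I
  refine (HT.seq (mulC_spec (by simp)) (T₂ := 30 + 20 * 4 ^ I.k) fun M₁ hF₁ h1 => (HT.seq
    (mulC_spec (by simp)) (T₂ := 20 + 10 * 4 ^ I.k) fun M₂ hF₂ h2 => (HT.seq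
    (mulC_spec (by simp)) (T₂ := 4) fun M₃ hF₃ h3 => HT.assign ?_).mono (fun _ _ h => h) ?_).mono
      (fun _ _ h => h) ?_).mono (fun _ _ h => h) ?_
  · simp [hM.q] at h1
    have c1 : M₁.var c = M.var c := hF₁.var c (by rw [hv1]; exact hv c (by simp))
    have w1 : M₁.var r_W = 4 ^ I.k := by rw [hF₁.var r_W (by rw [hv1]; decide), hM.W]
    simp [h1, c1, w1] at h2
    have b2 : M₂.var b = M.var b := by
      rw [hF₂.var b (by rw [hv1]; exact hv b (by simp)),
        hF₁.var b (by rw [hv1]; exact hv b (by simp))]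
    have w2 : M₂.var r_W = 4 ^ I.k := by rw [hF₂.var r_W (by rw [hv1]; decide), w1]
    simp [h2, b2, w2] at h3
    have d3 : M₃.var d = M.var d := by
      rw [hF₃.var d (by rw [hv1]; exact hv d (by simp)),
        hF₂.var d (by rw [hv1]; exact hv d (by simp)),
        hF₁.var d (by rw [hv1]; exact hv d (by simp))]
    simp [h3, d3, Input.idx]
  · have w2 : M₂.var r_W = 4 ^ I.k := by
      rw [hF₂.var r_W (by rw [hv1]; decide), hF₁.var r_W (by rw [hv1]; decide), hM.W]
    simp [w2]
    omega
  · have w1 : M₁.var r_W = 4 ^ I.k := by rw [hF₁.var r_W (by rw [hv1]; decide), hM.W]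
    simp [w1]
    omega
  · simp [hM.q]
    omega

/-! ### Bellman's equation and the tables -/

/-- The states for which the table has an entry. -/
structure State.Valid (I : Input) (s : State) : Prop where
  i : s.i ≤ I.m
  j : s.j ≤ I.q
  U : s.U < 4 ^ I.k
  V : s.V < 4 ^ I.k

/-- The cost of making no move: `0` in the final states, and otherwise a number larger than the
cost of any solution. -/
def State.base (I : Input) (s : State) : ℕ := if s.i = I.m ∧ s.j = I.q then 0 else I.m * I.q + 1

/-- `v` is the least cost to go from the state `s`, over the moves in `D` and making no move, where
`tab` lists the costs to go from the following states. It is attained by the move `(κ, b)` unless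
it is attained by making no move. Any `κ ≠ 0` stands for placing a question. -/
structure OptAt (I : Input) (tab : ℕ → ℕ) (s : State) (D : ℕ → ℕ → Prop) (v κ b : ℕ) : Prop where
  le_base : v ≤ s.base I
  le_move : ∀ κ' b' e, D κ' b' → Legal I κ' b' s e → v ≤ s.cost κ' + tab (I.idx (s.next κ' b'))
  attained : v = s.base I ∨ (b ≤ 2 * I.k ∧ (∃ e, Legal I κ b s e) ∧
    v = s.cost κ + tab (I.idx (s.next κ b)))

/-- The Bellman equation at the state `s`, for tables of the costs to go and of best moves. -/
def Bellman (I : Input) (tab kinds offs : ℕ → ℕ) (s : State) : Prop :=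
  OptAt I tab s (fun κ b => κ < 2 ∧ b ≤ 2 * I.k) (tab (I.idx s)) (kinds (I.idx s)) (offs (I.idx s))

theorem pair_inj {n a b a' b' : ℕ} (hb : b < n) (hb' : b' < n) (h : a * n + b = a' * n + b') :
    a = a' ∧ b = b' := by
  have hn : 0 < n := by omega
  have h1 : (a * n + b) / n = (a' * n + b') / n := by rw [h]
  rw [Nat.add_comm, Nat.add_mul_div_right _ _ hn, Nat.div_eq_of_lt hb, Nat.add_comm (a' * n),
    Nat.add_mul_div_right _ _ hn, Nat.div_eq_of_lt hb'] at h1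
  have h2 : a = a' := by omega
  subst h2
  exact ⟨rfl, by omega⟩

theorem pair_lt {n a b a' b' : ℕ} (hb : b < n) (h : a < a') : a * n + b < a' * n + b' := by
  have : (a + 1) * n ≤ a' * n := Nat.mul_le_mul_right n h
  rw [add_one_mul] at this
  omega

theorem State.Valid.idx_inj {I : Input} {s s' : State} (h : s.Valid I) (h' : s'.Valid I)
    (hh : I.idx s = I.idx s') : s = s' := by
  obtain ⟨h1, hV⟩ := pair_inj h.V h'.V hh
  obtain ⟨h1, hU⟩ := pair_inj h.U h'.U h1
  obtain ⟨hi, hj⟩ := pair_inj (Nat.lt_succ_of_le h.j) (Nat.lt_succ_of_le h'.j) h1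
  cases s; cases s'
  simp_all

/-- Moves lead to larger addresses, since `i` and `j` are the leading digits of an address. -/
theorem State.Valid.idx_lt_next {I : Input} {s : State} (hs : s.Valid I) (κ b : ℕ) :
    I.idx s < I.idx (s.next κ b) := by
  refine pair_lt hs.V (pair_lt hs.U ?_)
  unfold State.next
  split_ifs
  · exact pair_lt (Nat.lt_succ_of_le hs.j) (Nat.lt_succ_self _)
  · exact Nat.lt_succ_self _

/-- The entry of a state depends only on entries at larger addresses, so it stays correct when the
entries at other addresses are written. -/
theorem OptAt.congr {I : Input} {tab tab' : ℕ → ℕ} {s : State} {D : ℕ → ℕ → Prop} {v κ b : ℕ}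
    (hs : s.Valid I) (h : OptAt I tab s D v κ b)
    (ht : ∀ x, I.idx s < x → tab' x = tab x) : OptAt I tab' s D v κ b where
  le_base := h.le_base
  le_move κ' b' e hD hL := by
    rw [ht _ (hs.idx_lt_next κ' b')]
    exact h.le_move κ' b' e hD hL
  attained := by
    rw [ht _ (hs.idx_lt_next κ b)]
    exact h.attained

/-- Tries one move from the current state and keeps it if it is better than those before. -/
def relaxC : Cmd :=
  tryC ;;
  .ite (.var r_ok)
    (idxC r_iNew r_UNew r_jNew r_VNew ;; .assign 75 (.add (.var r_cost) (.arr 6 (.var r_idx))) ;;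
      .ite (.lt (.var 75) (.var r_best))
        (.assign r_best (.var 75) ;; .assign r_bestKind (.var r_kind) ;;
          .assign r_bestB (.var r_b))
        .skip)
    .skip

/-- The invariant of the search for the best move. -/
def Best (I : Input) (s : State) (D : ℕ → ℕ → Prop) (M : Mem) : Prop :=
  OptAt I (M.arr 6) s D (M.var r_best) (M.var r_bestKind) (M.var r_bestB)

theorem OptAt.mono {I : Input} {tab : ℕ → ℕ} {s : State} {D D' : ℕ → ℕ → Prop} {v κ b : ℕ}
    (h : OptAt I tab s D v κ b) (hD : ∀ κ b e, D' κ b → Legal I κ b s e → D κ b) :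
    OptAt I tab s D' v κ b :=
  ⟨h.le_base, fun κ b e hD' hL => h.le_move κ b e (hD κ b e hD' hL) hL, h.attained⟩

theorem relaxC_spec {I : Input} {M : Mem} (hM : Loaded I M) {s : State} (hs : stateOf M = s)
    (hv : s.Valid I) (hb : M.var r_b ≤ 2 * I.k) {D : ℕ → ℕ → Prop} (hD : Best I s D M) :
    HT relaxC M (1200 * I.unit)
      (Best I s fun κ b => D κ b ∨ κ = M.var r_kind ∧ b = M.var r_b) := by
  have hu : 1 ≤ I.unit := by have := (unit_bounds I).2.1; omega
  refine (HT.seq (tryC_spec hM hs hv.U.le hv.V.le hb) (T₂ := 80 * I.unit + 20)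
    fun M₁ hF₁ h1 => ?_).mono (fun _ _ h => h) ?_
  · have hD₁ : Best I s D M₁ := by
      unfold Best at *
      rw [hF₁.arr 6 (by decide), hF₁.var r_best (by decide), hF₁.var r_bestKind (by decide),
        hF₁.var r_bestB (by decide)]
      exact hD
    have hM₁ := hM.frame hF₁ (by decide)
    have eκ : M₁.var r_kind = M.var r_kind := hF₁.var _ (by decide)
    have eb : M₁.var r_b = M.var r_b := hF₁.var _ (by decide)
    refine (HT.ite (T₁ := 80 * I.unit + 17) (fun h => ?_) fun h => HT.skip ?_).mono
      (fun _ _ h => h) ?_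
    · simp at h
      refine (HT.seq (idxC_spec hM₁ (by decide)) (T₂ := 17) fun M₂ hF₂ h2 => (HT.assign_seq (HT.ite
        (fun h' => HT.assign_seq (HT.assign_seq (HT.assign ?_))) fun h' => HT.skip ?_)).mono
          (fun _ _ h => h) ?_).mono (fun _ _ h => h) ?_
      · simp at h'
        rw [hF₂.var r_best (by decide), hF₂.var r_cost (by decide), hF₂.arr 6 (by decide), h2,
          h1.2.1, h1.2.2] at h'
        have hL : Legal I (M.var r_kind) (M.var r_b) s (M₁.var r_elem) := by
          rcases h1.1 with hh | hh
          · exact absurd hh.1 h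
          · exact hh.2
        unfold Best
        simp
        rw [hF₂.var r_cost (by decide), hF₂.arr 6 (by decide), h2, h1.2.1, h1.2.2,
          hF₂.var r_kind (by decide), hF₂.var r_b (by decide), eκ, eb]
        refine ⟨h'.le.trans hD₁.le_base, fun κ' b' e hh hL' => ?_, Or.inr ⟨hb, ⟨_, hL⟩, rfl⟩⟩
        rcases hh with hh | ⟨rfl, rfl⟩
        · exact h'.le.trans (hD₁.le_move κ' b' e hh hL')
        · exact le_rfl
      · simp at h'
        rw [hF₂.var r_best (by decide), hF₂.var r_cost (by decide), hF₂.arr 6 (by decide), h2,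
          h1.2.1, h1.2.2] at h'
        unfold Best
        simp
        rw [hF₂.arr 6 (by decide), hF₂.var r_best (by decide), hF₂.var r_bestKind (by decide),
          hF₂.var r_bestB (by decide)]
        refine ⟨hD₁.le_base, fun κ' b' e hh hL' => ?_, hD₁.attained⟩
        rcases hh with hh | ⟨rfl, rfl⟩
        · exact hD₁.le_move κ' b' e hh hL'
        · exact h'
      · simp
      · simp
    · simp at h
      refine hD₁.mono fun κ b e hh hL => ?_
      rcases hh with hh | ⟨rfl, rfl⟩
      · exact hh
      · rcases h1.1 with hh | hh
        · exact absurd hL (hh.2 e)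
        · exact absurd h hh.1
    · simp
      omega
  · omega

/-- Fills the entry of the current state into the table `6` of the costs to go and the tables `7`
and `8` of the best moves. -/
def stepC : Cmd :=
  .assign r_best (.var r_big) ;;
  .ite (.eq (.var r_i) (.var 1)) (.ite (.eq (.var r_j) (.var 2)) (.assign r_best (.const 0)) .skip)
    .skip ;;
  .loop r_b (.add (.add (.var 0) (.var 0)) (.const 1))
    (.assign r_kind (.const 0) ;; relaxC ;; .assign r_kind (.const 1) ;; relaxC) ;;
  idxC r_i r_U r_j r_V ;;
  .store 6 (.var r_idx) (.var r_best) ;;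
  .store 7 (.var r_idx) (.var r_bestKind) ;;
  .store 8 (.var r_idx) (.var r_bestB)

/-- The Bellman equation holds at all states with addresses from `N` on. -/
def Done (I : Input) (N : ℕ) (M : Mem) : Prop :=
  ∀ s : State, s.Valid I → N ≤ I.idx s → Bellman I (M.arr 6) (M.arr 7) (M.arr 8) s

theorem stepC_spec {I : Input} {M : Mem} (hM : Loaded I M) {s : State} (hs : stateOf M = s)
    (hv : s.Valid I) (hD : Done I (I.idx s + 1) M) :
    HT stepC M (10000 * (I.unit * (I.k + 1))) (Done I (I.idx s)) := by
  have hu : 1 ≤ I.unit := by have := (unit_bounds I).2.1; omega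
  have hs1 : M.var r_i = s.i := by rw [← hs]; rfl
  have hs3 : M.var r_j = s.j := by rw [← hs]; rfl
  refine (HT.assign_seq (HT.seq (R := fun M₁ => M₁.var r_best = s.base I) (T₁ := 12)
    (T₂ := 50 + 80 * I.unit + (2 * I.k + 1) * (2400 * I.unit + 20)) ?_ fun M₁ hF₁ h1 =>
      (HT.seq (R := Best I s fun κ b => κ < 2 ∧ b ≤ 2 * I.k)
        (T₁ := 10 + (2 * I.k + 1) * (2400 * I.unit + 20)) (T₂ := 80 * I.unit + 30)
        ?_ fun M₂ hF₂ h2 =>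
        (HT.seq (idxC_spec (I := I) ?_ (by decide)) (T₂ := 10) fun M₃ hF₃ h3 =>
          (HT.store_seq (HT.store_seq (HT.store ?_))).mono (fun _ _ h => h) ?_).mono
            (fun _ _ h => h) ?_).mono (fun _ _ h => h) ?_)).mono (fun _ _ h => h) ?_
  · refine (HT.ite (T₂ := 1) (fun h => HT.ite (T₁ := 2) (T₂ := 1) (fun h' => HT.assign ?_)
      fun h' => HT.skip ?_) fun h => HT.skip ?_).mono (fun _ _ h => h) ?_
    · simp [hs1, hs3, hM.m, hM.q] at h h'
      simp [State.base, h, h']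
    · simp [hs1, hs3, hM.m, hM.q] at h h'
      simp [State.base, h, h', hM.big]
    · simp [hs1, hM.m] at h
      simp [State.base, h, hM.big]
    · simp
  · have hM₁ := (hM.setVar (x := r_best) (v := M.var r_big) (by decide)).frame hF₁ (by decide)
    have hs₁ : stateOf M₁ = s := by
      rw [← hs]
      unfold stateOf
      rw [hF₁.var _ (by decide), hF₁.var _ (by decide), hF₁.var _ (by decide),
        hF₁.var _ (by decide)]
      simp
    refine (HT.loop (T := 2400 * I.unit + 10)
      (fun n => Best I s fun κ b => κ < 2 ∧ n ≤ b ∧ b ≤ 2 * I.k) ?_ (by decide) ?_ ?_).mono ?_ ?_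
    · intro n M v h; simpa [Best] using h
    · simp [hM₁.k]
      exact ⟨h1.le, fun κ' b' e h => by omega, Or.inl h1⟩
    · intro b hb M₂ hF₂ h2 hI
      have hM₂ := hM₁.frame hF₂ (by decide)
      have hs₂ : stateOf M₂ = s := by
        rw [← hs₁]
        unfold stateOf
        rw [hF₂.var _ (by decide), hF₂.var _ (by decide), hF₂.var _ (by decide),
          hF₂.var _ (by decide)]
      simp [hM₁.k] at hb
      have hD₃ : ∀ (M₃ : Mem) {D : ℕ → ℕ → Prop}, Best I s D M₃ →
          Best I s D (M₃.setVar r_kind 1) := fun M₃ D h => by simpa [Best] using h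
      refine (HT.assign_seq (HT.seq (relaxC_spec (s := s)
          (D := fun κ b' => κ < 2 ∧ b + 1 ≤ b' ∧ b' ≤ 2 * I.k) (hM₂.setVar (by decide)) ?_ hv ?_ ?_)
        (T₂ := 1200 * I.unit + 5) fun M₃ hF₃ h3 => (HT.assign_seq ((relaxC_spec (s := s)
          (((hM₂.setVar (x := r_kind) (v := 0) (by decide)).frame hF₃ (by decide)).setVar
            (by decide)) ?_ hv ?_ (hD₃ M₃ h3)).mono ?_ le_rfl)).mono
              (fun _ _ h => h) ?_)).mono (fun _ _ h => h) ?_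
      · simpa [stateOf] using hs₂
      · simp [h2]; omega
      · simpa [Best] using hI
      · rw [← hs₂]
        unfold stateOf
        simp
        rw [hF₃.var _ (by decide), hF₃.var _ (by decide), hF₃.var _ (by decide),
          hF₃.var _ (by decide)]
        simp
      · simp
        rw [hF₃.var _ (by decide)]
        simp [h2]; omega
      · intro M₄ hF₄ h4
        have e15 : M₃.var r_b = b := by rw [hF₃.var _ (by decide)]; simp [h2]
        refine h4.mono fun κ' b' e hh _ => ?_
        simp [h2, e15]
        omega
      · simp
        omega
      · simp
        omega
    · intro M₂ hF₂ h2
      exact h2.mono fun κ b e h _ => ⟨h.1, Nat.zero_le _, h.2⟩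
    · simp [hM₁.k]
      nlinarith
  · exact ((hM.setVar (x := r_best) (v := M.var r_big) (by decide)).frame hF₁ (by decide)).frame hF₂
      (by decide)
  · have e6 : M₃.arr 6 = M.arr 6 := by
      rw [hF₃.arr _ (by decide), hF₂.arr _ (by decide), hF₁.arr _ (by decide)]; simp
    have e7 : M₃.arr 7 = M.arr 7 := by
      rw [hF₃.arr _ (by decide), hF₂.arr _ (by decide), hF₁.arr _ (by decide)]; simp
    have e8 : M₃.arr 8 = M.arr 8 := by
      rw [hF₃.arr _ (by decide), hF₂.arr _ (by decide), hF₁.arr _ (by decide)]; simp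
    have e62 : M₂.arr 6 = M.arr 6 := by
      rw [hF₂.arr _ (by decide), hF₁.arr _ (by decide)]; simp
    have es : (⟨M₂.var r_i, M₂.var r_U, M₂.var r_j, M₂.var r_V⟩ : State) = s := by
      rw [← hs]
      unfold stateOf
      rw [hF₂.var _ (by decide), hF₂.var _ (by decide), hF₂.var _ (by decide),
        hF₂.var _ (by decide), hF₁.var _ (by decide), hF₁.var _ (by decide),
        hF₁.var _ (by decide), hF₁.var _ (by decide)]
      simp
    rw [es] at h3
    intro s' hv' hN
    simp [h3, e6, e7, e8]
    rw [hF₃.var r_best (by decide), hF₃.var r_bestKind (by decide), hF₃.var r_bestB (by decide)]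
    rcases Nat.eq_or_lt_of_le hN with h | h
    · have := hv.idx_inj hv' h
      subst this
      unfold Bellman
      rw [Function.update_self, Function.update_self, Function.update_self]
      unfold Best at h2
      rw [e62] at h2
      exact h2.congr hv fun x hx => by rw [Function.update_of_ne hx.ne']
    · have := hD s' hv' h
      unfold Bellman at this ⊢
      rw [Function.update_of_ne h.ne', Function.update_of_ne h.ne', Function.update_of_ne h.ne']
      exact this.congr hv' fun x hx => by rw [Function.update_of_ne (h.trans hx).ne']
  · simp
  · omega
  · omega
  · simp
    nlinarith

/-- Fills the tables, with the states in the order of decreasing addresses. -/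
def fillC : Cmd :=
  .loop r_i (.add (.var 1) (.const 1)) (.loop r_j (.add (.var 2) (.const 1))
    (.loop r_U (.var r_W) (.loop r_V (.var r_W) stepC)))

theorem Done.congr {I : Input} {N N' : ℕ} {M : Mem} (h : Done I N M) (hN : N' = N) :
    Done I N' M := hN ▸ h

theorem fillC_spec {I : Input} {M : Mem} (hM : Loaded I M) :
    HT fillC M (20 + (I.m + 1) * (20 + (I.q + 1) * (20 + 4 ^ I.k * (20 + 4 ^ I.k *
      (10000 * (I.unit * (I.k + 1)) + 6))))) (Done I 0) := by
  have hx : ∀ (f : ℕ → ℕ) (x n : ℕ) (M : Mem) (v : ℕ), Done I (f n) M →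
    Done I (f n) (M.setVar x v) := fun _ _ _ _ _ h => h
  refine (HT.loop (T := 7 + (I.q + 1) * (20 + 4 ^ I.k * (20 + 4 ^ I.k *
      (10000 * (I.unit * (I.k + 1)) + 6))))
      (fun n => Done I (n * (I.q + 1) * 4 ^ I.k * 4 ^ I.k)) (hx _ _) (by decide) ?_ ?_).mono
      ?_ ?_
  · intro s hs hN
    -- All addresses are below the initial threshold.
    exfalso
    refine absurd hN (not_le.2 ?_)
    have : I.idx s < ((I.m + 1) * (I.q + 1) * 4 ^ I.k) * 4 ^ I.k + 0 := by
      refine pair_lt hs.V ?_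
      refine (pair_lt (b' := 0) hs.U ?_ : _ < (I.m + 1) * (I.q + 1) * 4 ^ I.k + 0)
      exact (pair_lt (b' := 0) (Nat.lt_succ_of_le hs.j) (Nat.lt_succ_of_le hs.i))
    simpa [hM.m] using this
  · intro i hi M₁ hF₁ h1 hI
    simp [hM.m] at hi
    have hM₁ := hM.frame hF₁ (by decide)
    refine (HT.loop (T := 7 + 4 ^ I.k * (20 + 4 ^ I.k * (10000 * (I.unit * (I.k + 1)) + 6)))
      (fun n => Done I ((i * (I.q + 1) + n) * 4 ^ I.k * 4 ^ I.k)) (hx _ _) (by decide) ?_ ?_).mono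
      ?_ ?_
    · refine hI.congr ?_
      simp [hM₁.q]
      ring
    · intro j hj M₂ hF₂ h2 hI
      simp [hM₁.q] at hj
      have hM₂ := hM₁.frame hF₂ (by decide)
      refine (HT.loop (T := 7 + 4 ^ I.k * (10000 * (I.unit * (I.k + 1)) + 6))
        (fun n => Done I (((i * (I.q + 1) + j) * 4 ^ I.k + n) * 4 ^ I.k)) (hx _ _) (by decide)
        ?_ ?_).mono ?_ ?_
      · refine hI.congr ?_
        simp [hM₂.W]
        ring
      · intro U hU M₃ hF₃ h3 hI
        simp [hM₂.W] at hU
        have hM₃ := hM₂.frame hF₃ (by decide)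
        refine (HT.loop (T := 10000 * (I.unit * (I.k + 1)))
          (fun n => Done I (((i * (I.q + 1) + j) * 4 ^ I.k + U) * 4 ^ I.k + n)) (hx _ _)
          (by decide) ?_ ?_).mono ?_ ?_
        · refine hI.congr ?_
          simp [hM₃.W]
          ring
        · intro V hV M₄ hF₄ h4 hI
          simp [hM₃.W] at hV
          have hM₄ := hM₃.frame hF₄ (by decide)
          refine stepC_spec hM₄ (s := ⟨i, U, j, V⟩) ?_ ⟨?_, ?_, hU, hV⟩ hI
          · unfold stateOf
            rw [h4, hF₄.var r_U (by decide), h3, hF₄.var r_j (by decide), hF₃.var r_j (by decide),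
              h2, hF₄.var r_i (by decide), hF₃.var r_i (by decide), hF₂.var r_i (by decide), h1]
          · simp only; omega
          · simp only; omega
        · intro M₄ _ h
          exact h.congr (by ring)
        · simp [hM₃.W]
      · intro M₄ _ h
        exact h.congr (by ring)
      · simp [hM₂.W]
        rw [show 20 + 4 ^ I.k * (10000 * (I.unit * (I.k + 1)) + 6) =
          7 + 4 ^ I.k * (10000 * (I.unit * (I.k + 1)) + 6) + 6 + 7 by ring, mul_add (4 ^ I.k) _ 7]
        omega
    · intro M₄ _ h
      exact h.congr (by ring)
    · simp [hM₁.q]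
      rw [show 20 + 4 ^ I.k * (20 + 4 ^ I.k * (10000 * (I.unit * (I.k + 1)) + 6)) =
        7 + 4 ^ I.k * (20 + 4 ^ I.k * (10000 * (I.unit * (I.k + 1)) + 6)) + 6 + 7 by ring,
        mul_add (I.q + 1) _ 7]
      omega
  · intro M₄ _ h
    exact h.congr (by ring)
  · simp [hM.m]
    rw [show 20 + (I.q + 1) * (20 + 4 ^ I.k * (20 + 4 ^ I.k * (10000 * (I.unit * (I.k + 1)) + 6))) =
      7 + (I.q + 1) * (20 + 4 ^ I.k * (20 + 4 ^ I.k * (10000 * (I.unit * (I.k + 1)) + 6))) + 6 + 7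
      by ring, mul_add (I.m + 1) _ 7]
    omega

/-! ### Solutions as paths in the state space -/

/-- Adding a power of two whose bit is clear sets that bit. -/
theorem testBit_add_two_pow {U b : ℕ} (h : U.testBit b = false) (x : ℕ) :
    (U + 2 ^ b).testBit x = (U.testBit x || decide (x = b)) := by
  induction b generalizing U x with
  | zero =>
    rw [Nat.testBit_zero] at h
    have h : U % 2 = 0 := by simpa using h
    cases x with
    | zero => simp; omega
    | succ x =>
      rw [Nat.testBit_succ, Nat.testBit_succ, show (U + 2 ^ 0) / 2 = U / 2 by omega]
      simp
  | succ b ih =>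
    rw [Nat.testBit_succ] at h
    cases x with
    | zero => simp [Nat.testBit_zero, pow_succ]
    | succ x =>
      rw [Nat.testBit_succ, Nat.testBit_succ U, show (U + 2 ^ (b + 1)) / 2 = U / 2 + 2 ^ b by
        rw [pow_succ]; omega, ih h]
      simp

/-- Placing the element at `i + b` and passing on to `i + 1`: the bit `b` is set, and the mask is
shifted. The bit that is shifted out stands for the position `i`, which counts as occupied from now
on, whether or not it was. -/
theorem inSet_next {k i U b P : ℕ} (hb : b ≤ 2 * k) (hU : U < 4 ^ k)
    (h : ¬ InSet k i U (i + b)) :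
    InSet k (i + 1) ((U + 2 ^ b) / 2) P ↔ InSet k i U P ∨ P = i ∨ P = i + b := by
  have hUb : U.testBit b = false := by
    by_contra hh
    exact h (Or.inr ⟨by omega, by simpa using hh⟩)
  unfold InSet
  rw [← Nat.testBit_succ, testBit_add_two_pow hUb]
  rcases lt_or_ge P (i + 1) with h1 | h1
  · simp only [h1, true_or, true_iff]
    omega
  · have h2 : (P - (i + 1)).succ = P - i := by omega
    rw [h2]
    have h3 : P - i = b ↔ P = i + b := by omega
    have h4 : U.testBit (P - i) → P ≤ i + 2 * k := fun hh => by
      by_contra hlt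
      rw [Nat.testBit_lt_two_pow] at hh
      · exact Bool.false_ne_true hh
      · calc U < 4 ^ k := hU
          _ = 2 ^ (2 * k) := by rw [pow_mul]; norm_num
          _ ≤ _ := Nat.pow_le_pow_right (by norm_num) (by omega)
    rw [Bool.or_eq_true, decide_eq_true_iff, h3]
    constructor
    · rintro (h | ⟨-, h | h⟩)
      · omega
      · exact Or.inl (Or.inr ⟨h4 h, h⟩)
      · exact Or.inr (Or.inr h)
    · rintro ((h | ⟨-, h⟩) | h | h)
      · omega
      · exact Or.inr ⟨by have := h4 h; omega, Or.inl h⟩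
      · omega
      · exact Or.inr ⟨by omega, Or.inr h⟩

/-- The first `i` entries of the sequence `es` are distinct elements, among `r` elements with
initial positions `A`, and every one of them is at distance at most `k` from its initial position. -/
structure NearSeq (k r : ℕ) (A es : ℕ → ℕ) (i : ℕ) : Prop where
  lt : ∀ c < i, es c < r
  lo : ∀ c < i, c ≤ A (es c) + k
  hi : ∀ c < i, A (es c) ≤ c + k
  inj : ∀ c < i, ∀ c' < i, es c = es c' → c = c'

/-- The pair `(i, U)` encodes the set of the first `i` entries of the sequence `es`, together with
the shifted positions below `k`, which belong to no element, and all positions below `i`. If the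
sequence can be completed, the element at the shifted position `P` is placed at time `P` at the
latest, so including the positions below `i` adds no element that is not placed. -/
structure Side (k r : ℕ) (A es : ℕ → ℕ) (i U : ℕ) : Prop extends NearSeq k r A es i where
  le : i ≤ r
  mask : U < 4 ^ k
  mem : ∀ P, InSet k i U P ↔ P < k ∨ P < i ∨ ∃ c < i, A (es c) + k = P

theorem NearSeq.congr {k r i : ℕ} {A es es' : ℕ → ℕ} (h : NearSeq k r A es i)
    (he : ∀ c < i, es' c = es c) : NearSeq k r A es' i where
  lt c hc := he c hc ▸ h.lt c hc
  lo c hc := he c hc ▸ h.lo c hc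
  hi c hc := he c hc ▸ h.hi c hc
  inj c hc c' hc' := by rw [he c hc, he c' hc']; exact h.inj c hc c' hc'

theorem Side.congr {k r i U : ℕ} {A es es' : ℕ → ℕ} (h : Side k r A es i U)
    (he : ∀ c < i, es' c = es c) : Side k r A es' i U where
  toNearSeq := h.toNearSeq.congr he
  le := h.le
  mask := h.mask
  mem P := by
    rw [h.mem]
    have : (∃ c < i, A (es c) + k = P) ↔ ∃ c < i, A (es' c) + k = P :=
      exists_congr fun c => and_congr_right fun hc => by rw [he c hc]
    rw [this]

/-- The mask `2 ^ k - 1` occupies exactly the shifted positions below `k`, which belong to no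
element. -/
theorem Side.zero (k r : ℕ) (A es : ℕ → ℕ) : Side k r A es 0 (2 ^ k - 1) where
  lt c hc := by omega
  lo c hc := by omega
  hi c hc := by omega
  inj c hc := by omega
  le := Nat.zero_le _
  mask := by
    have h : 2 ^ k ≤ 4 ^ k := two_pow_le (by omega)
    have : 0 < 2 ^ k := by positivity
    omega
  mem P := by
    simp [InSet]
    omega

theorem Side.step {k r i U b : ℕ} {A es : ℕ → ℕ} (h : Side k r A es i U) (hb : b ≤ 2 * k)
    (hp : CanPick k r A i U b (es i)) : Side k r A es (i + 1) ((U + 2 ^ b) / 2) := by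
  obtain ⟨h1, h2, h3, h4⟩ := hp
  have hcase : ∀ c, c < i + 1 → c < i ∨ c = i := fun c hc => by omega
  have hnew : ∀ c < i, es c ≠ es i := fun c hc he =>
    h4 ((h.mem _).2 (Or.inr (Or.inr ⟨c, hc, by rw [he, h3]⟩)))
  refine ⟨⟨fun c hc => ?_, fun c hc => ?_, fun c hc => ?_, fun c hc c' hc' he => ?_⟩, h1, ?_,
    fun P => ?_⟩
  · rcases hcase c hc with hc | rfl
    · exact h.lt c hc
    · exact h2
  · rcases hcase c hc with hc | rfl
    · exact h.lo c hc
    · omega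
  · rcases hcase c hc with hc | rfl
    · exact h.hi c hc
    · omega
  · rcases hcase c hc with hc | rfl <;> rcases hcase c' hc' with hc' | rfl
    · exact h.inj c hc c' hc' he
    · exact absurd he (hnew c hc)
    · exact absurd he.symm (hnew c' hc')
    · rfl
  · have := two_pow_le hb
    have := h.mask
    omega
  · rw [inSet_next hb h.mask h4, h.mem]
    constructor
    · rintro ((h | h | ⟨c, hc, h⟩) | h | h)
      · exact Or.inl h
      · exact Or.inr (Or.inl (by omega))
      · exact Or.inr (Or.inr ⟨c, by omega, h⟩)
      · exact Or.inr (Or.inl (by omega))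
      · exact Or.inr (Or.inr ⟨i, by omega, by omega⟩)
    · rintro (h | h | ⟨c, hc, h⟩)
      · exact Or.inl (Or.inl h)
      · omega
      · rcases hcase c hc with hc | rfl
        · exact Or.inl (Or.inr (Or.inr ⟨c, hc, h⟩))
        · omega

/-- The next element of a near sequence can be picked from every state that encodes the elements
before it. -/
theorem Side.canPick {k r i U n : ℕ} {A es : ℕ → ℕ} (h : Side k r A es i U)
    (hs : NearSeq k r A es n) (hi : i < n) (hn : n ≤ r)
    (hA : ∀ e < r, ∀ e' < r, A e = A e' → e = e') :
    A (es i) + k - i ≤ 2 * k ∧ CanPick k r A i U (A (es i) + k - i) (es i) := by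
  have h1 := hs.lo i hi
  have h2 := hs.hi i hi
  refine ⟨by omega, by omega, hs.lt i hi, by omega, ?_⟩
  rw [Nat.add_sub_cancel' h1, h.mem]
  rintro (hh | hh | ⟨c, hc, hh⟩)
  · omega
  · omega
  · have := hs.inj c (by omega) i hi
      (hA _ (hs.lt c (by omega)) _ (hs.lt i hi) (by omega))
    omega

/-- A sequence of `r` distinct elements among `r` misses none. -/
theorem NearSeq.surj {k r : ℕ} {A es : ℕ → ℕ} (h : NearSeq k r A es r) {e : ℕ} (he : e < r) :
    ∃ c < r, es c = e := by
  have hinj : Function.Injective fun c : Fin r => (⟨es c, h.lt c c.2⟩ : Fin r) := fun c c' hcc =>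
    Fin.ext (h.inj c c.2 c' c'.2 (by simpa using hcc))
  obtain ⟨c, hc⟩ := Finite.surjective_of_injective hinj ⟨e, he⟩
  exact ⟨c, c.2, by simpa using hc⟩

/-- A solution in the form of two sequences: `es` lists the students from the weakest to the
strongest, `et` lists the questions from the easiest to the hardest, and the neighbors of the
student `es c` are the first `a c` questions. -/
structure Chain (I : Input) (es et a : ℕ → ℕ) : Prop where
  students : NearSeq I.k I.m (I.mem.arr 0) es I.m
  questions : NearSeq I.k I.q (I.mem.arr 1) et I.q
  mono : ∀ c c', c ≤ c' → c' < I.m → a c ≤ a c'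
  le : ∀ c < I.m, a c ≤ I.q
  covers : ∀ c < I.m, ∀ t < I.q, I.mem.arr 2 (es c * I.q + t) ≠ 0 → ∃ c' < a c, et c' = t

theorem mem_arr_one_inj (I : Input) {e e' : ℕ} (h : e < I.q) (h' : e' < I.q)
    (hh : I.mem.arr 1 e = I.mem.arr 1 e') : e = e' := by
  have h1 := mem_arr_one I ⟨e, h⟩
  have h2 := mem_arr_one I ⟨e', h'⟩
  have := I.β.injective (Fin.ext (h1.symm.trans (hh.trans h2)))
  simpa using this

/-- The initial state: no real position is occupied. -/
def root (I : Input) : State := ⟨0, 2 ^ I.k - 1, 0, 2 ^ I.k - 1⟩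

/-- The cost to go from the initial state is at most the cost of any solution, because a solution
is a path in the state space. -/
theorem Chain.le_cost {I : Input} {es et a : ℕ → ℕ} (h : Chain I es et a) {M : Mem}
    (hM : Done I 0 M) : M.arr 6 (I.idx (root I)) ≤ ∑ c ∈ Finset.range I.m, a c := by
  have key : ∀ n i U j V, n = (I.m - i) + (I.q - j) → Side I.k I.m (I.mem.arr 0) es i U →
      Side I.k I.q (I.mem.arr 1) et j V → (∀ c, i ≤ c → c < I.m → j ≤ a c) →
      M.arr 6 (I.idx ⟨i, U, j, V⟩) ≤ ∑ c ∈ Finset.Ico i I.m, a c := by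
    intro n
    induction n with
    | zero =>
      intro i U j V hn hU hV ha
      have hi : i = I.m := by have := hU.le; omega
      have hj : j = I.q := by have := hV.le; omega
      have := (hM ⟨i, U, j, V⟩ ⟨hU.le, hV.le, hU.mask, hV.mask⟩ (Nat.zero_le _)).le_base
      simpa [State.base, hi, hj] using this
    | succ n ih =>
      intro i U j V hn hU hV ha
      have hB := hM ⟨i, U, j, V⟩ ⟨hU.le, hV.le, hU.mask, hV.mask⟩ (Nat.zero_le _)
      -- The solution continues with the next student if the student's degree is `j`, and
      -- otherwise with the next question.
      by_cases hs : i < I.m ∧ a i = j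
      · obtain ⟨hi, hj⟩ := hs
        obtain ⟨hb, hp⟩ := hU.canPick h.students hi le_rfl
          fun e he e' he' hh => mem_arr_zero_inj I he he' hh
        refine (hB.le_move 0 _ (es i) ⟨by norm_num, hb⟩ ⟨hp, fun t ht hE => ?_⟩).trans ?_
        · obtain ⟨c, hc, rfl⟩ := h.covers i hi t ht hE
          exact (hV.mem _).2 (Or.inr (Or.inr ⟨c, hj ▸ hc, rfl⟩))
        · have := ih (i + 1) _ j V (by omega) (hU.step hb hp) hV
            fun c hc hc' => ha c (by omega) hc'
          rw [Finset.sum_eq_sum_Ico_succ_bot hi, hj]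
          simpa [State.next, State.cost] using this
      · have hj : j < I.q ∧ ∀ c, i ≤ c → c < I.m → j + 1 ≤ a c := by
          rcases Nat.lt_or_ge i I.m with hi | hi
          · have h1 : j < a i := lt_of_le_of_ne (ha i le_rfl hi) fun hh => hs ⟨hi, hh.symm⟩
            exact ⟨h1.trans_le (h.le i hi), fun c hc hc' => h1.trans_le (h.mono i c hc hc')⟩
          · exact ⟨by have := hV.le; omega, fun c hc hc' => by omega⟩
        obtain ⟨hb, hp⟩ := hV.canPick h.questions hj.1 le_rfl
          fun e he e' he' hh => mem_arr_one_inj I he he' hh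
        refine (hB.le_move 1 _ (et j) ⟨by norm_num, hb⟩ hp).trans ?_
        have := ih i U (j + 1) _ (by omega) hU (hV.step hb hp) hj.2
        simpa [State.next, State.cost] using this
  have := key _ 0 _ 0 _ rfl (Side.zero _ _ _ es) (Side.zero _ _ _ et) fun _ _ _ => Nat.zero_le _
  rwa [Finset.range_eq_Ico]

/-- A partial solution, in the notation of `Chain`, that leads to the state `s`. A question with
shifted position below `a c` need not have been placed when it is counted as placed; but it has been
if the partial solution can be completed. -/
structure Trace (I : Input) (s : State) (es et a : ℕ → ℕ) : Prop where
  students : Side I.k I.m (I.mem.arr 0) es s.i s.U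
  questions : Side I.k I.q (I.mem.arr 1) et s.j s.V
  mono : ∀ c c', c ≤ c' → c' < s.i → a c ≤ a c'
  le : ∀ c < s.i, a c ≤ s.j
  covers : ∀ c < s.i, ∀ t < I.q, I.mem.arr 2 (es c * I.q + t) ≠ 0 →
    I.mem.arr 1 t + I.k < a c ∨ ∃ c' < a c, et c' = t

theorem Trace.zero (I : Input) (es et a : ℕ → ℕ) : Trace I (root I) es et a where
  students := Side.zero _ _ _ _
  questions := Side.zero _ _ _ _
  mono _ _ _ h := absurd h (Nat.not_lt_zero _)
  le _ h := absurd h (Nat.not_lt_zero _)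
  covers _ h := absurd h (Nat.not_lt_zero _)

theorem Trace.valid {I : Input} {s : State} {es et a : ℕ → ℕ} (h : Trace I s es et a) :
    s.Valid I :=
  ⟨h.students.le, h.questions.le, h.students.mask, h.questions.mask⟩

theorem Trace.student {I : Input} {s : State} {es et a : ℕ → ℕ} {b e : ℕ}
    (h : Trace I s es et a) (hb : b ≤ 2 * I.k) (hL : Legal I 0 b s e) :
    Trace I (s.next 0 b) (Function.update es s.i e) et (Function.update a s.i s.j) := by
  have hL : CanPick I.k I.m (I.mem.arr 0) s.i s.U b e ∧ Fits I s e := by simpa [Legal] using hL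
  have hu : ∀ {f : ℕ → ℕ} {v c : ℕ}, c < s.i → Function.update f s.i v c = f c :=
    fun hc => Function.update_of_ne hc.ne _ _
  have hcase : ∀ c, c < s.i + 1 → c < s.i ∨ c = s.i := fun c hc => by omega
  have hn : s.next 0 b = ⟨s.i + 1, (s.U + 2 ^ b) / 2, s.j, s.V⟩ := by simp [State.next]
  rw [hn]
  refine ⟨(h.students.congr fun c hc => hu hc).step hb (by simpa using hL.1), h.questions,
    fun c c' hc hc' => ?_, fun c hc => ?_, fun c hc t ht hE => ?_⟩
  · rcases hcase c' hc' with hc' | rfl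
    · rw [hu hc', hu (by omega)]
      exact h.mono c c' hc hc'
    · rcases hcase c (by omega) with hc | rfl
      · rw [hu hc, Function.update_self]
        exact h.le c hc
      · exact le_rfl
  · rcases hcase c hc with hc | rfl
    · rw [hu hc]
      exact h.le c hc
    · rw [Function.update_self]
  · rcases hcase c hc with hc | rfl
    · rw [hu hc] at hE ⊢
      exact h.covers c hc t ht hE
    · rw [Function.update_self] at hE ⊢
      rcases (h.questions.mem _).1 (hL.2 t ht hE) with hh | hh | ⟨c, hc, hh⟩
      · omega
      · exact Or.inl hh
      · exact Or.inr ⟨c, hc, mem_arr_one_inj I (h.questions.lt c hc) ht (by omega)⟩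

theorem Trace.question {I : Input} {s : State} {es et a : ℕ → ℕ} {κ b e : ℕ} (hκ : κ ≠ 0)
    (h : Trace I s es et a) (hb : b ≤ 2 * I.k) (hL : Legal I κ b s e) :
    Trace I (s.next κ b) es (Function.update et s.j e) a := by
  have hL : CanPick I.k I.q (I.mem.arr 1) s.j s.V b e := by simpa [Legal, hκ] using hL
  have hu : ∀ {f : ℕ → ℕ} {v c : ℕ}, c < s.j → Function.update f s.j v c = f c :=
    fun hc => Function.update_of_ne hc.ne _ _
  have hn : s.next κ b = ⟨s.i, s.U, s.j + 1, (s.V + 2 ^ b) / 2⟩ := by simp [State.next, hκ]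
  rw [hn]
  refine ⟨h.students, (h.questions.congr fun c hc => hu hc).step hb (by simpa using hL),
    h.mono, fun c hc => (h.le c hc).trans (Nat.le_succ _), fun c hc t ht hE => ?_⟩
  rcases h.covers c hc t ht hE with hh | ⟨c', hc', hh⟩
  · exact Or.inl hh
  · have := h.le c hc
    exact Or.inr ⟨c', hc', by rw [hu (by omega), hh]⟩

theorem Trace.chain {I : Input} {s : State} {es et a : ℕ → ℕ} (h : Trace I s es et a)
    (hi : s.i = I.m) (hj : s.j = I.q) : Chain I es et a where
  students := hi ▸ h.students.toNearSeq
  questions := hj ▸ h.questions.toNearSeq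
  mono := hi ▸ h.mono
  le := hi ▸ hj ▸ h.le
  covers c hc t ht hE := by
    rcases h.covers c (hi ▸ hc) t ht hE with hh | hh
    · have hq : NearSeq I.k I.q (I.mem.arr 1) et I.q := hj ▸ h.questions.toNearSeq
      obtain ⟨c', hc', rfl⟩ := hq.surj ht
      exact ⟨c', (hq.lo c' hc').trans_lt hh, rfl⟩
    · exact hh

/-! ### Sequences and orderings -/

theorem mem_arr_two (I : Input) (s : Fin I.m) (t : Fin I.q) :
    I.mem.arr 2 ((s : ℕ) * I.q + t) ≠ 0 ↔ (s, t) ∈ I.edges := by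
  have : (∃ e ∈ I.edges, (s : ℕ) * I.q + t = (e.1 : ℕ) * I.q + e.2) ↔ (s, t) ∈ I.edges := by
    constructor
    · rintro ⟨⟨s', t'⟩, he, hh⟩
      obtain ⟨h1, h2⟩ := pair_inj t.2 t'.2 hh
      rwa [Fin.ext h1, Fin.ext h2]
    · exact fun h => ⟨_, h, rfl⟩
  simp only [Input.mem, OfNat.ofNat_ne_zero, if_false, OfNat.ofNat_ne_one, if_true, this]
  simp

/-- A near ordering lists the elements in a near sequence. -/
theorem exists_nearSeq {k r : ℕ} {A : ℕ → ℕ} {α π : Equiv.Perm (Fin r)}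
    (hA : ∀ s : Fin r, A s = (α s : ℕ)) (h : Near k α π) :
    ∃ es : ℕ → ℕ, NearSeq k r A es r ∧ ∀ c : Fin r, es c = (π.symm c : ℕ) := by
  obtain ⟨es, hes⟩ : ∃ es : ℕ → ℕ, ∀ c (hc : c < r), es c = (π.symm ⟨c, hc⟩ : ℕ) :=
    ⟨fun c => if h : c < r then (π.symm ⟨c, h⟩ : ℕ) else 0, fun c hc => dif_pos hc⟩
  refine ⟨es, ⟨fun c hc => ?_, fun c hc => ?_, fun c hc => ?_, fun c hc c' hc' he => ?_⟩,
    fun c => hes c c.2⟩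
  · rw [hes c hc]; exact (π.symm ⟨c, hc⟩).2
  · rw [hes c hc, hA]
    have := (h (π.symm ⟨c, hc⟩)).2
    simp only [Equiv.apply_symm_apply] at this
    omega
  · rw [hes c hc, hA]
    have := (h (π.symm ⟨c, hc⟩)).1
    simp only [Equiv.apply_symm_apply] at this
    omega
  · rw [hes c hc, hes c' hc'] at he
    simpa using π.symm.injective (Fin.ext he)

/-- A complete near sequence lists the elements in a near ordering. -/
theorem NearSeq.exists_near {k r : ℕ} {A es : ℕ → ℕ} {α : Equiv.Perm (Fin r)}
    (hA : ∀ s : Fin r, A s = (α s : ℕ)) (h : NearSeq k r A es r) :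
    ∃ π : Equiv.Perm (Fin r), Near k α π ∧ ∀ s : Fin r, es (π s) = s := by
  have hinj : Function.Injective fun c : Fin r => (⟨es c, h.lt c c.2⟩ : Fin r) := fun c c' hcc =>
    Fin.ext (h.inj c c.2 c' c'.2 (by simpa using hcc))
  set e := Equiv.ofBijective _ (Finite.injective_iff_bijective.1 hinj)
  have he : ∀ s, es (e.symm s) = s := fun s => congrArg Fin.val (e.apply_symm_apply s)
  refine ⟨e.symm, fun s => ?_, he⟩
  have h1 := h.lo _ (e.symm s).2
  have h2 := h.hi _ (e.symm s).2
  rw [he, hA] at h1 h2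
  omega

theorem card_lt_eq {q j : ℕ} (σ : Equiv.Perm (Fin q)) (hj : j ≤ q) :
    ∑ t : Fin q, (if (σ t : ℕ) < j then 1 else 0) = j := by
  rw [Equiv.sum_comp σ fun u : Fin q => if (u : ℕ) < j then 1 else 0,
    Fin.sum_univ_eq_sum_range (fun u => if u < j then 1 else 0) q, Finset.sum_ite,
    Finset.sum_const_zero, add_zero, Finset.sum_const, smul_eq_mul, mul_one]
  have : (Finset.range q).filter (· < j) = Finset.range j := by
    ext x
    simp only [Finset.mem_filter, Finset.mem_range]
    omega
  rw [this, Finset.card_range]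

theorem card_eq_sum {m q : ℕ} {D : Finset (Fin m × Fin q)} {a : ℕ → ℕ} (π : Equiv.Perm (Fin m))
    (σ : Equiv.Perm (Fin q)) (ha : ∀ c < m, a c ≤ q)
    (hD : ∀ s t, (s, t) ∈ D ↔ (σ t : ℕ) < a (π s)) :
    D.card = ∑ c ∈ Finset.range m, a c := by
  calc D.card = ∑ p : Fin m × Fin q, if p ∈ D then 1 else 0 := by simp
    _ = ∑ s : Fin m, ∑ t : Fin q, if (s, t) ∈ D then 1 else 0 := Fintype.sum_prod_type _
    _ = ∑ s : Fin m, a (π s) := by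
      refine Finset.sum_congr rfl fun s _ => ?_
      simp only [hD]
      exact card_lt_eq σ (ha _ (π s).2)
    _ = ∑ c : Fin m, a c := Equiv.sum_comp π fun c : Fin m => a c
    _ = _ := Fin.sum_univ_eq_sum_range a m

theorem Feasible.chain {I : Input} {F : Finset (Fin I.m × Fin I.q)} {π : Equiv.Perm (Fin I.m)}
    {σ : Equiv.Perm (Fin I.q)} (h : Feasible I F π σ) :
    ∃ es et a, Chain I es et a ∧ ∑ c ∈ Finset.range I.m, a c = I.edges.card + F.card := by
  classical
  obtain ⟨hd, hπ, hσ, hN, hI⟩ := h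
  obtain ⟨es, hes, hes'⟩ := exists_nearSeq (mem_arr_zero I) hπ
  obtain ⟨et, het, het'⟩ := exists_nearSeq (mem_arr_one I) hσ
  choose J hJ using hI
  have hD : ∀ s t, (s, t) ∈ I.edges ∪ F ↔ (σ t : ℕ) < min (J s) I.q := fun s t => by
    have : t ∈ nbhd (I.edges ∪ F) s ↔ (σ t : ℕ) < J s := by rw [hJ s]; rfl
    rw [lt_min_iff, and_iff_left (σ t).2, ← this]
    rfl
  let a : ℕ → ℕ := fun c => if hc : c < I.m then min (J (π.symm ⟨c, hc⟩)) I.q else 0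
  have ha : ∀ c (hc : c < I.m), a c = min (J (π.symm ⟨c, hc⟩)) I.q := fun c hc => dif_pos hc
  have ha' : ∀ c < I.m, a c ≤ I.q := fun c hc => by rw [ha c hc]; exact min_le_right _ _
  refine ⟨es, et, a, ⟨hes, het, fun c c' hc hc' => ?_, ha', fun c hc t ht hE => ?_⟩, ?_⟩
  · rw [ha c (by omega), ha c' hc']
    set s := π.symm ⟨c, by omega⟩ with hs
    set s' := π.symm ⟨c', hc'⟩ with hs'
    have hsub := hN s' s (by rw [hs, hs']; simpa using hc)
    rw [← card_lt_eq σ (min_le_right (J s) I.q), ← card_lt_eq σ (min_le_right (J s') I.q)]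
    refine Finset.sum_le_sum fun t _ => ?_
    simp only [← hD]
    split_ifs with h1 h2
    · exact le_rfl
    · exact absurd (hsub h1) h2
    · exact Nat.zero_le _
    · exact le_rfl
  · have h1 := hes' ⟨c, hc⟩
    simp only at h1
    rw [h1] at hE
    have h2 := (mem_arr_two I (π.symm ⟨c, hc⟩) ⟨t, ht⟩).1 hE
    have h3 := (hD _ _).1 (Finset.mem_union_left F h2)
    refine ⟨σ ⟨t, ht⟩, by rwa [ha c hc], ?_⟩
    rw [het', Equiv.symm_apply_apply]
  · rw [← Finset.card_union_of_disjoint hd, card_eq_sum π σ ha' fun s t => ?_]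
    rw [hD, ha _ (π s).2]
    simp

theorem Chain.feasible {I : Input} {es et a : ℕ → ℕ} (h : Chain I es et a) :
    ∃ F π σ, Feasible I F π σ ∧ (∀ s : Fin I.m, es (π s) = s) ∧ (∀ t : Fin I.q, et (σ t) = t) ∧
      (∀ s t, (s, t) ∈ F ↔ (σ t : ℕ) < a (π s) ∧ (s, t) ∉ I.edges) ∧
      ∑ c ∈ Finset.range I.m, a c = I.edges.card + F.card := by
  classical
  obtain ⟨π, hπ, hes⟩ := h.students.exists_near (mem_arr_zero I)
  obtain ⟨σ, hσ, het⟩ := h.questions.exists_near (mem_arr_one I)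
  set F : Finset (Fin I.m × Fin I.q) :=
    Finset.univ.filter fun p => (σ p.2 : ℕ) < a (π p.1) ∧ p ∉ I.edges with hF
  have hmem : ∀ s t, (s, t) ∈ F ↔ (σ t : ℕ) < a (π s) ∧ (s, t) ∉ I.edges := fun s t => by
    simp [hF]
  have hE : ∀ s t, (s, t) ∈ I.edges → (σ t : ℕ) < a (π s) := fun s t hst => by
    obtain ⟨c, hc, hh⟩ := h.covers (π s) (π s).2 t t.2 (by
      rw [hes]; exact (mem_arr_two I s t).2 hst)
    have hcq : c < I.q := hc.trans_le (h.le _ (π s).2)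
    rwa [h.questions.inj (σ t) (σ t).2 c hcq (by rw [het, hh])]
  have hD : ∀ s t, (s, t) ∈ I.edges ∪ F ↔ (σ t : ℕ) < a (π s) := fun s t => by
    rw [Finset.mem_union, hmem]
    have := hE s t
    tauto
  have hdis : Disjoint I.edges F := Finset.disjoint_left.2 fun p hp hp' =>
    ((hmem p.1 p.2).1 hp').2 hp
  refine ⟨F, π, σ, ⟨hdis, hπ, hσ, fun s₁ s₂ hs t ht => ?_, fun s => ⟨a (π s), ?_⟩⟩, hes, het, hmem,
    ?_⟩
  · exact (hD _ _).2 (((hD _ _).1 ht).trans_le (h.mono _ _ hs (π s₁).2))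
  · ext t
    exact hD s t
  · rw [← Finset.card_union_of_disjoint hdis, card_eq_sum π σ h.le hD]

theorem near_refl {r : ℕ} (k : ℕ) (α : Equiv.Perm (Fin r)) : Near k α α := fun x => by omega

/-- Adding all missing edges is a solution. -/
theorem exists_chain (I : Input) : ∃ es et, Chain I es et fun _ => I.q := by
  obtain ⟨es, hes, -⟩ := exists_nearSeq (mem_arr_zero I) (near_refl I.k I.α)
  obtain ⟨et, het, -⟩ := exists_nearSeq (mem_arr_one I) (near_refl I.k I.β)
  exact ⟨es, et, hes, het, fun _ _ _ _ => le_rfl, fun _ _ => le_rfl, fun c _ t ht _ =>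
    het.surj ht⟩

theorem Done.root_lt {I : Input} {M : Mem} (h : Done I 0 M) :
    M.arr 6 (I.idx (root I)) < I.m * I.q + 1 := by
  obtain ⟨es, et, hc⟩ := exists_chain I
  have := hc.le_cost h
  simp at this
  omega

/-! ### Following the best moves -/

/-- The arrays `A₃`, `A₄`, `A₉` hold the positions of the placed students, those of the placed
questions, and the degrees of the placed students in a partial solution of cost `v` that leads to
the state `s`. -/
def Traced (I : Input) (s : State) (A₃ A₄ A₉ : ℕ → ℕ) (v : ℕ) : Prop :=
  ∃ es et a, Trace I s es et a ∧ (∀ c < s.i, A₃ (es c) = c ∧ A₉ (es c) = a c) ∧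
    (∀ c < s.j, A₄ (et c) = c) ∧ ∑ c ∈ Finset.range s.i, a c = v

theorem Traced.student {I : Input} {s : State} {A₃ A₄ A₉ : ℕ → ℕ} {v b e : ℕ}
    (h : Traced I s A₃ A₄ A₉ v) (hb : b ≤ 2 * I.k) (hL : Legal I 0 b s e) :
    Traced I (s.next 0 b) (Function.update A₃ e s.i) A₄ (Function.update A₉ e s.j)
      (v + s.cost 0) := by
  obtain ⟨es, et, a, hT, h3, h4, hv⟩ := h
  have hT' := hT.student hb hL
  have hn : s.next 0 b = ⟨s.i + 1, (s.U + 2 ^ b) / 2, s.j, s.V⟩ := by simp [State.next]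
  refine ⟨_, _, _, hT', fun c hc => ?_, ?_, ?_⟩
  · rw [hn] at hc
    rcases Nat.lt_succ_iff_lt_or_eq.1 hc with hc | rfl
    · have hne : es c ≠ e := fun he => by
        have := hT'.students.inj c (by rw [hn]; simp only; omega) s.i (by rw [hn]; simp)
          (by rw [Function.update_self, Function.update_of_ne hc.ne, he])
        omega
      rw [Function.update_of_ne hc.ne, Function.update_of_ne hc.ne, Function.update_of_ne hne,
        Function.update_of_ne hne]
      exact h3 c hc
    · simp
  · rw [hn]; exact h4
  · rw [hn]
    simp only
    rw [Finset.sum_range_succ, Function.update_self, ← hv]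
    congr 1
    exact Finset.sum_congr rfl fun c hc => Function.update_of_ne (Finset.mem_range.1 hc).ne _ _

theorem Traced.question {I : Input} {s : State} {A₃ A₄ A₉ : ℕ → ℕ} {v κ b e : ℕ} (hκ : κ ≠ 0)
    (h : Traced I s A₃ A₄ A₉ v) (hb : b ≤ 2 * I.k) (hL : Legal I κ b s e) :
    Traced I (s.next κ b) A₃ (Function.update A₄ e s.j) A₉ (v + s.cost κ) := by
  obtain ⟨es, et, a, hT, h3, h4, hv⟩ := h
  have hT' := hT.question hκ hb hL
  have hn : s.next κ b = ⟨s.i, s.U, s.j + 1, (s.V + 2 ^ b) / 2⟩ := by simp [State.next, hκ]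
  refine ⟨_, _, _, hT', ?_, fun c hc => ?_, ?_⟩
  · rw [hn]; exact h3
  · rw [hn] at hc
    rcases Nat.lt_succ_iff_lt_or_eq.1 hc with hc | rfl
    · have hne : et c ≠ e := fun he => by
        have := hT'.questions.inj c (by rw [hn]; simp only; omega) s.j (by rw [hn]; simp)
          (by rw [Function.update_self, Function.update_of_ne hc.ne, he])
        omega
      rw [Function.update_of_ne hc.ne, Function.update_of_ne hne]
      exact h4 c hc
    · simp
  · rw [hn]
    simpa [State.cost, hκ] using hv

/-- Makes the best move from the current state and records it. -/
def traceStepC : Cmd :=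
  idxC r_i r_U r_j r_V ;;
  .assign r_kind (.arr 7 (.var r_idx)) ;; .assign r_b (.arr 8 (.var r_idx)) ;;
  tryC ;;
  .ite (.eq (.var r_kind) (.const 0))
    (.store 3 (.var r_elem) (.var r_i) ;; .store 9 (.var r_elem) (.var r_j))
    (.store 4 (.var r_elem) (.var r_j)) ;;
  .assign r_i (.var r_iNew) ;; .assign r_U (.var r_UNew) ;; .assign r_j (.var r_jNew) ;;
  .assign r_V (.var r_VNew)

/-- The invariant of the trace: the recorded partial solution can be completed to an optimal
one. -/
def TraceInv (I : Input) (M : Mem) : Prop :=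
  ∃ v, Traced I (stateOf M) (M.arr 3) (M.arr 4) (M.arr 9) v ∧
    v + M.arr 6 (I.idx (stateOf M)) = M.arr 6 (I.idx (root I))

theorem traceStepC_spec {I : Input} {M : Mem} (hM : Loaded I M) (hD : Done I 0 M)
    (hT : TraceInv I M) (hlt : (stateOf M).i + (stateOf M).j < I.m + I.q) :
    HT traceStepC M (1250 * I.unit) (fun M' => TraceInv I M' ∧
      (stateOf M').i + (stateOf M').j = (stateOf M).i + (stateOf M).j + 1) := by
  obtain ⟨v, hT, hv⟩ := hT
  set s := stateOf M with hs
  have hu : 1 ≤ I.unit := by have := (unit_bounds I).2.1; omega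
  have hval : s.Valid I := by obtain ⟨es, et, a, h, -⟩ := hT; exact h.valid
  -- The cost to go is below `base`, as it is at most that of the initial state; so it is attained
  -- by a move.
  obtain ⟨hb2, ⟨e, hL⟩, hcost⟩ := (hD s hval (Nat.zero_le _)).attained.resolve_left fun h => by
    have h1 : s.base I = I.m * I.q + 1 := if_neg (by omega)
    have := hD.root_lt
    omega
  set κ := M.arr 7 (I.idx s) with hκ
  set b := M.arr 8 (I.idx s) with hb
  have hs1 : M.var r_i = s.i := rfl
  have hs3 : M.var r_j = s.j := rfl
  refine (HT.seq (idxC_spec hM (by decide)) (T₂ := 50 + 1100 * I.unit) fun M₁ hF₁ h1 =>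
    (HT.assign_seq (HT.assign_seq (HT.seq (tryC_spec (I := I) (s := s) ?_ ?_ hval.U.le hval.V.le ?_)
      (T₂ := 30) fun M₂ hF₂ h2 => (HT.seq (T₁ := 13) (T₂ := 8) (R := fun M₃ =>
        Traced I (s.next κ b) (M₃.arr 3) (M₃.arr 4) (M₃.arr 9) (v + s.cost κ)) ?_ fun M₃ hF₃ h3 =>
        HT.assign_seq (HT.assign_seq (HT.assign_seq (HT.assign ?_)))).mono (fun _ _ h => h)
          ?_))).mono (fun _ _ h => h) ?_).mono (fun _ _ h => h) ?_
  · exact ((hM.frame hF₁ (by decide)).setVar (by decide)).setVar (by decide)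
  · rw [hs]
    unfold stateOf
    simp
    rw [hF₁.var r_i (by decide), hF₁.var r_U (by decide), hF₁.var r_j (by decide),
      hF₁.var r_V (by decide)]
    simp
  · have h1 : M₁.var r_idx = I.idx s := h1
    simp [h1, hF₁.arr 8 (by decide), ← hb, hb2]
  · have h1 : M₁.var r_idx = I.idx s := h1
    simp [h1, hF₁.arr 8 (by decide), hF₁.arr 7 (by decide), ← hb, ← hκ] at h2
    have hLe : Legal I κ b s (M₂.var r_elem) := by
      rcases h2.1 with h | h
      · exact absurd hL (h.2 e)
      · exact h.2
    have e14 : M₂.var r_kind = κ := by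
      rw [hF₂.var _ (by decide)]
      simp [h1, hF₁.arr 7 (by decide), ← hκ]
    have e10 : M₂.var r_i = s.i := by
      rw [hF₂.var _ (by decide)]
      simp [hF₁.var r_i (by decide), hs1]
    have e12 : M₂.var r_j = s.j := by
      rw [hF₂.var _ (by decide)]
      simp [hF₁.var r_j (by decide), hs3]
    have a3 : M₂.arr 3 = M.arr 3 := by
      rw [hF₂.arr _ (by decide)]; simp; rw [hF₁.arr _ (by decide)]
    have a4 : M₂.arr 4 = M.arr 4 := by
      rw [hF₂.arr _ (by decide)]; simp; rw [hF₁.arr _ (by decide)]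
    have a9 : M₂.arr 9 = M.arr 9 := by
      rw [hF₂.arr _ (by decide)]; simp; rw [hF₁.arr _ (by decide)]
    refine (HT.ite (fun h => HT.store_seq (HT.store ?_)) fun h => HT.store ?_).mono
      (fun _ _ h => h) (by simp)
    · have hκ0 : κ = 0 := by simpa [e14] using h
      rw [hκ0] at hLe ⊢
      simpa [e10, e12, a3, a4, a9] using hT.student hb2 hLe
    · have hκ0 : κ ≠ 0 := by simpa [e14] using h
      simpa [e10, e12, a3, a4, a9] using hT.question hκ0 hb2 hLe
  · have h1 : M₁.var r_idx = I.idx s := h1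
    simp [h1, hF₁.arr 8 (by decide), hF₁.arr 7 (by decide), ← hb, ← hκ] at h2
    have a6 : M₃.arr 6 = M.arr 6 := by
      rw [hF₃.arr _ (by decide), hF₂.arr _ (by decide)]; simp; rw [hF₁.arr _ (by decide)]
    set M₄ := (((M₃.setVar r_i (Exp.eval M₃ (.var r_iNew))).setVar r_U
      (Exp.eval (M₃.setVar r_i (Exp.eval M₃ (.var r_iNew))) (.var r_UNew))).setVar r_j _).setVar
        r_V _ with hM₄
    have hst : stateOf M₄ = s.next κ b := by
      rw [← h2.2.1, hM₄]
      simp [stateOf]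
      rw [hF₃.var _ (by decide), hF₃.var _ (by decide), hF₃.var _ (by decide),
        hF₃.var _ (by decide)]
      simp
    refine ⟨⟨v + s.cost κ, ?_, ?_⟩, ?_⟩
    · rw [hst]
      simpa [hM₄] using h3
    · rw [hst]
      simp [hM₄, a6]
      omega
    · rw [hst]
      unfold State.next
      split_ifs <;> simp only <;> omega
  · simp
  · simp
    omega
  · omega

/-- Follows the best moves from the initial state and records the solution in the arrays `3`, `4`
and `9`. -/
def traceC : Cmd :=
  powC (.var 0) ;;
  .assign r_i (.const 0) ;; .assign r_j (.const 0) ;;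
  .assign r_U (.sub (.var r_p) (.const 1)) ;; .assign r_V (.sub (.var r_p) (.const 1)) ;;
  .loop 84 (.add (.var 1) (.var 2)) traceStepC

theorem traceC_spec {I : Input} {M : Mem} (hM : Loaded I M) (hD : Done I 0 M) :
    HT traceC M (40 + 10 * I.k + (I.m + I.q) * (1250 * I.unit + 6)) (fun M' =>
      ∃ s : State, s.i = I.m ∧ s.j = I.q ∧
        Traced I s (M'.arr 3) (M'.arr 4) (M'.arr 9) (M.arr 6 (I.idx (root I)))) := by
  refine (HT.seq powC_spec (T₂ := 30 + (I.m + I.q) * (1250 * I.unit + 6)) fun M₁ hF₁ h1 =>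
    (HT.assign_seq (HT.assign_seq (HT.assign_seq (HT.assign_seq (HT.loop (T := 1250 * I.unit)
      (fun n M' => TraceInv I M' ∧ (stateOf M').i + (stateOf M').j + n = I.m + I.q) ?_ (by decide)
        ?_ ?_))))).mono ?_ ?_).mono (fun _ _ h => h) ?_
  · intro n M v h
    simpa [TraceInv, stateOf] using h
  · simp [hM.k] at h1
    constructor
    · refine ⟨0, ?_, ?_⟩
      · refine ⟨fun _ => 0, fun _ => 0, fun _ => 0, ?_, ?_, ?_, ?_⟩ <;> simp [stateOf, h1]
        exact Trace.zero _ _ _ _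
      · simp [stateOf, h1, root]
    · simp [stateOf]
      rw [hF₁.var _ (by decide), hF₁.var _ (by decide), hM.m, hM.q]
  · rintro i hi M₂ hF₂ - ⟨hI, hI'⟩
    have hM₁ := hM.frame hF₁ (by decide)
    have hM₂ := ((((hM₁.setVar (x := r_i) (v := 0) (by decide)).setVar (x := r_j) (v := 0)
      (by decide)).setVar (x := r_U) (v := M₁.var r_p - 1) (by decide)).setVar (x := r_V)
      (v := M₁.var r_p - 1) (by decide)).frame (M' := M₂) (c := Cmd.loop 84 _ traceStepC)
      (by simpa using hF₂) (by decide)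
    have hD₂ : Done I 0 M₂ := by
      unfold Done
      rw [hF₂.arr 6 (by decide), hF₂.arr 7 (by decide), hF₂.arr 8 (by decide)]
      simp
      rw [hF₁.arr 6 (by decide), hF₁.arr 7 (by decide), hF₁.arr 8 (by decide)]
      simpa [Done] using hD
    refine (traceStepC_spec hM₂ hD₂ hI (by omega)).mono (fun M₃ _ h => ⟨h.1, by omega⟩) le_rfl
  · rintro M₂ hF₂ ⟨⟨v, hT, hv⟩, hI⟩
    have a6 : M₂.arr 6 = M.arr 6 := by rw [hF₂.arr _ (by decide)]; rw [hF₁.arr _ (by decide)]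
    rw [a6] at hv
    have hval : (stateOf M₂).Valid I := by obtain ⟨es, et, a, h, -⟩ := hT; exact h.valid
    have hi : (stateOf M₂).i = I.m := by have := hval.i; have := hval.j; omega
    have hj : (stateOf M₂).j = I.q := by have := hval.i; have := hval.j; omega
    have := (hD _ hval (Nat.zero_le _)).le_base
    simp [State.base, hi, hj] at this
    rw [this, add_zero] at hv
    exact ⟨_, hi, hj, hv ▸ hT⟩
  · simp
    rw [hF₁.var _ (by decide), hF₁.var _ (by decide), hM.m, hM.q]
    omega
  · simp [hM.k]
    omega

/-! ### Listing the added edges -/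

/-- Lists the added edges in the array `5` and counts them in the register `3`. -/
def outC : Cmd :=
  .assign 3 (.const 0) ;;
  .loop r_i (.var 1)
    (mulC (.var r_i) (.var 2) ;; .assign 67 (.var r_prod) ;;
      .loop r_j (.var 2)
        (.ite (.lt (.arr 4 (.var r_j)) (.arr 9 (.var r_i)))
          (.ite (.arr 2 (.add (.var 67) (.var r_j)))
            (.store 5 (.add (.var 67) (.var r_j)) (.const 0))
            (.store 5 (.add (.var 67) (.var r_j)) (.const 1) ;;
              .assign 3 (.add (.var 3) (.const 1))))
          (.store 5 (.add (.var 67) (.var r_j)) (.const 0))))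

/-- The entry of the matrix of added edges at the address `x`. -/
def added (I : Input) (A₄ A₉ : ℕ → ℕ) (x : ℕ) : ℕ :=
  if A₄ (x % I.q) < A₉ (x / I.q) ∧ I.mem.arr 2 x = 0 then 1 else 0

theorem added_apply (I : Input) (A₄ A₉ : ℕ → ℕ) {s t : ℕ} (ht : t < I.q) :
    added I A₄ A₉ (s * I.q + t) =
      if A₄ t < A₉ s ∧ I.mem.arr 2 (s * I.q + t) = 0 then 1 else 0 := by
  have hq : 0 < I.q := by omega
  have h1 : (s * I.q + t) / I.q = s := by
    rw [Nat.add_comm, Nat.add_mul_div_right _ _ hq, Nat.div_eq_of_lt ht, zero_add]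
  have h2 : (s * I.q + t) % I.q = t := by
    rw [Nat.add_comm, Nat.add_mul_mod_self_right, Nat.mod_eq_of_lt ht]
  rw [added, h1, h2]

/-- The entries of the matrix of added edges from the address `N` on are listed and counted. -/
def Listed (I : Input) (A₄ A₉ : ℕ → ℕ) (N : ℕ) (M : Mem) : Prop :=
  M.var 3 = ∑ x ∈ Finset.Ico N (I.m * I.q), added I A₄ A₉ x ∧
    ∀ x, N ≤ x → x < I.m * I.q → M.arr 5 x = added I A₄ A₉ x

theorem Listed.step {I : Input} {A₄ A₉ : ℕ → ℕ} {N : ℕ} {M M' : Mem}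
    (h : Listed I A₄ A₉ (N + 1) M) (hN : N < I.m * I.q)
    (h3 : M'.var 3 = added I A₄ A₉ N + M.var 3)
    (h5 : M'.arr 5 = Function.update (M.arr 5) N (added I A₄ A₉ N)) : Listed I A₄ A₉ N M' := by
  constructor
  · rw [h3, h.1, Finset.sum_eq_sum_Ico_succ_bot hN]
  · intro x hx hx'
    rw [h5]
    rcases Nat.eq_or_lt_of_le hx with rfl | hx
    · simp
    · rw [Function.update_of_ne hx.ne']
      exact h.2 x hx hx'

theorem outC_spec {I : Input} {M : Mem} (hM : Loaded I M) :
    HT outC M (20 + I.m * (40 + I.q * 60)) (Listed I (M.arr 4) (M.arr 9) 0) := by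
  refine (HT.assign_seq (HT.loop (T := 20 + I.q * 60)
    (fun n => Listed I (M.arr 4) (M.arr 9) (n * I.q)) ?_ (by decide) ?_ ?_)).mono ?_ ?_
  · intro n M v h
    simpa [Listed] using h
  · simp [hM.m, Listed]
    intro x h h'
    omega
  · intro i hi M₁ hF₁ h1 hI
    have hM₁ := (hM.setVar (x := 3) (v := 0) (by decide)).frame hF₁ (by decide)
    have a4 : M₁.arr 4 = M.arr 4 := by rw [hF₁.arr _ (by decide)]; simp
    have a9 : M₁.arr 9 = M.arr 9 := by rw [hF₁.arr _ (by decide)]; simp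
    simp [hM.m] at hi
    refine (HT.seq (mulC_spec (by simp)) (T₂ := 10 + I.q * 44) fun M₂ hF₂ h2 =>
      (HT.assign_seq (HT.loop (T := 36)
        (fun n => Listed I (M.arr 4) (M.arr 9) (i * I.q + n)) ?_ (by decide) ?_ ?_)).mono
          ?_ ?_).mono (fun _ _ h => h) ?_
    · intro n M v h
      simpa [Listed] using h
    · have e2 : M₂.var 2 = I.q := by rw [hF₂.var _ (by decide), hM₁.q]
      have e3 : M₂.var 3 = M₁.var 3 := hF₂.var _ (by decide)
      have a5 : M₂.arr 5 = M₁.arr 5 := hF₂.arr _ (by decide)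
      rw [add_one_mul] at hI
      simpa [Listed, e2, e3, a5] using hI
    · intro j hj M₃ hF₃ h3 hI
      have hM₂ := hM₁.frame hF₂ (by decide)
      have hM₃ := (hM₂.setVar (x := 67) (v := M₂.var r_prod) (by decide)).frame hF₃ (by decide)
      simp [hM₂.q] at hj
      have e67 : M₃.var 67 = i * I.q := by
        rw [hF₃.var _ (by decide)]
        simp [h2, h1, hM₁.q]
      have e10 : M₃.var r_i = i := by
        rw [hF₃.var _ (by decide)]
        simp [hF₂.var r_i (by decide), h1]
      have b4 : M₃.arr 4 = M.arr 4 := by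
        rw [hF₃.arr _ (by decide)]
        simp [hF₂.arr 4 (by decide), a4]
      have b9 : M₃.arr 9 = M.arr 9 := by
        rw [hF₃.arr _ (by decide)]
        simp [hF₂.arr 9 (by decide), a9]
      have hlt : i * I.q + j < I.m * I.q := by
        simpa using pair_lt (b' := 0) hj hi
      refine (HT.ite (T₁ := 20) (T₂ := 5) (fun h => ?_) fun h => HT.store ?_).mono
        (fun _ _ h => h) ?_
      · simp [b4, b9, e10, h3] at h
        refine (HT.ite (fun h' => HT.store ?_) fun h' => HT.store_seq (HT.assign ?_)).mono
          (fun _ _ h => h) (by simp)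
        · simp [e67, h3, hM₃.arr2] at h'
          have : added I (M.arr 4) (M.arr 9) (i * I.q + j) = 0 := by
            rw [added_apply _ _ _ hj, if_neg (by tauto)]
          exact hI.step hlt (by simp [this]) (by simp [this, e67, h3])
        · simp [e67, h3, hM₃.arr2] at h'
          have : added I (M.arr 4) (M.arr 9) (i * I.q + j) = 1 := by
            rw [added_apply _ _ _ hj, if_pos ⟨h, h'⟩]
          exact hI.step hlt (by simp [this]; omega) (by simp [this, e67, h3])
      · simp [b4, b9, e10, h3] at h
        have : added I (M.arr 4) (M.arr 9) (i * I.q + j) = 0 := by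
          rw [added_apply _ _ _ hj, if_neg (by omega)]
        exact hI.step hlt (by simp [this]) (by simp [this, e67, h3])
      · simp
    · intro M₃ _ h
      exact h
    · have e2 : M₂.var 2 = I.q := by rw [hF₂.var _ (by decide), hM₁.q]
      simp [e2]
      omega
    · simp [hM₁.q]
      omega
  · intro M₁ _ h
    simpa using h
  · simp [hM.m]
    nlinarith

/-! ### The algorithm and its running time -/

/-- Computes the number `4 ^ k` of masks and the upper bound `m q + 1` of all costs. -/
def setupC : Cmd :=
  powC (.add (.var 0) (.var 0)) ;; .assign r_W (.var r_p) ;;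
  mulC (.var 1) (.var 2) ;; .assign r_big (.add (.var r_prod) (.const 1))

theorem setupC_spec (I : Input) :
    HT setupC I.mem (100 + 20 * I.k + 10 * I.q) (Loaded I) := by
  have i0 : I.mem.var 0 = I.k := by simp [Input.mem]
  have i1 : I.mem.var 1 = I.m := by simp [Input.mem]
  have i2 : I.mem.var 2 = I.q := by simp [Input.mem]
  refine (HT.seq powC_spec (T₂ := 50 + 10 * I.q) fun M₁ hF₁ h1 => (HT.assign_seq (HT.seq (T₂ := 4)
    (mulC_spec (by simp)) fun M₂ hF₂ h2 => HT.assign ?_)).mono (fun _ _ h => h) ?_).mono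
      (fun _ _ h => h) ?_
  · constructor
    · simp; rw [hF₂.var _ (by decide)]; simp; rw [hF₁.var _ (by decide), i0]
    · simp; rw [hF₂.var _ (by decide)]; simp; rw [hF₁.var _ (by decide), i1]
    · simp; rw [hF₂.var _ (by decide)]; simp; rw [hF₁.var _ (by decide), i2]
    · simp; rw [hF₂.var _ (by decide)]; simp; rw [h1]; simp [i0]
      rw [← two_mul, pow_mul]; norm_num
    · simp at h2
      simp [h2]; rw [hF₁.var _ (by decide), i1, hF₁.var _ (by decide), i2]
    · simp; rw [hF₂.arr _ (by decide)]; simp; rw [hF₁.arr _ (by decide)]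
    · simp; rw [hF₂.arr _ (by decide)]; simp; rw [hF₁.arr _ (by decide)]
    · simp; rw [hF₂.arr _ (by decide)]; simp; rw [hF₁.arr _ (by decide)]
  · simp
    rw [hF₁.var _ (by decide), i2]
    omega
  · simp [i0]
    omega

/-- The program that solves Both `k`-near Addition. -/
def solveC : Cmd := setupC ;; fillC ;; traceC ;; outC

theorem sum_added {I : Input} {A₄ A₉ : ℕ → ℕ} {F : Finset (Fin I.m × Fin I.q)}
    (h : ∀ s t, added I A₄ A₉ ((s : Fin I.m) * I.q + (t : Fin I.q)) = if (s, t) ∈ F then 1 else 0) :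
    ∑ x ∈ Finset.range (I.m * I.q), added I A₄ A₉ x = F.card := by
  rw [← Fin.sum_univ_eq_sum_range, ← Equiv.sum_comp finProdFinEquiv]
  calc _ = ∑ p : Fin I.m × Fin I.q, if p ∈ F then 1 else 0 := by
        refine Finset.sum_congr rfl fun p _ => ?_
        rw [← h p.1 p.2, finProdFinEquiv_apply_val, Nat.add_comm, Nat.mul_comm]
    _ = F.card := by simp

theorem solveC_spec (I : Input) :
    HT solveC I.mem (200 + 30 * I.k + 10 * I.q +
      (20 + (I.m + 1) * (20 + (I.q + 1) * (20 + 4 ^ I.k * (20 + 4 ^ I.k *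
        (10000 * (I.unit * (I.k + 1)) + 6))))) +
      (40 + 10 * I.k + (I.m + I.q) * (1250 * I.unit + 6)) + (20 + I.m * (40 + I.q * 60)))
      (Solved I) := by
  refine (HT.seq (setupC_spec I) (T₂ := _) fun M₂ hF₂ hL => HT.seq (T₂ := _)
    (fillC_spec hL) fun M₃ hF₃ h3 => HT.seq (T₂ := _) (traceC_spec (hL.frame hF₃ (by decide)) h3)
    fun M₄ hF₄ h4 => (outC_spec ((hL.frame hF₃ (by decide)).frame hF₄ (by decide))).mono ?_
      le_rfl).mono (fun _ _ h => h) ?_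
  · intro M₅ hF₅ h5
    obtain ⟨s, hi, hj, es, et, a, hT, ht3, ht4, hv⟩ := h4
    rw [hi] at ht3 hv
    rw [hj] at ht4
    obtain ⟨F, π, σ, hfeas, hes, het, hF, hsum⟩ := (hT.chain hi hj).feasible
    have hπ : ∀ s : Fin I.m, M₄.arr 3 s = (π s : ℕ) ∧ M₄.arr 9 s = a (π s) := fun s => by
      have := ht3 (π s) (π s).2
      rwa [hes] at this
    have hσ : ∀ t : Fin I.q, M₄.arr 4 t = (σ t : ℕ) := fun t => by
      have := ht4 (σ t) (σ t).2
      rwa [het] at this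
    -- The array `5` is the matrix of the added edges of the traced solution.
    have hadd : ∀ (s : Fin I.m) (t : Fin I.q), added I (M₄.arr 4) (M₄.arr 9) ((s : ℕ) * I.q + t) =
        if (s, t) ∈ F then 1 else 0 := fun s t => by
      rw [added_apply _ _ _ t.2, hσ, (hπ s).2]
      have h2 := mem_arr_two I s t
      have : I.mem.arr 2 ((s : ℕ) * I.q + t) = 0 ↔ (s, t) ∉ I.edges := by
        rw [← h2, not_not]
      simp only [this, hF]
    have hcard : M₅.var 3 = F.card := by
      rw [h5.1, ← Finset.range_eq_Ico]
      exact sum_added hadd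
    refine ⟨⟨⟨F, π, σ, hfeas, hcard.symm⟩, ?_⟩, F, π, σ, hfeas, hcard, fun s => ?_, fun t => ?_,
      fun s t => ?_⟩
    · rintro _ ⟨F', π', σ', hfeas', rfl⟩
      obtain ⟨es', et', a', hc', hs'⟩ := hfeas'.chain
      have := hc'.le_cost h3
      rw [hcard]
      omega
    · rw [hF₅.arr 3 (by decide), (hπ s).1]
    · rw [hF₅.arr 4 (by decide), hσ]
    · rw [h5.2 _ (Nat.zero_le _), hadd]
      simpa using pair_lt (b' := 0) t.2 s.2
  · omega

/-- For `k ≥ 3` this holds since `64 ≤ 3 ^ 4`; the constant takes care of `k = 1` and `k = 2`. -/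

theorem sixtyfour_pow_le {k : ℕ} (hk : 1 ≤ k) : 64 ^ k ≤ 4096 * k ^ (4 * k) := by
  rcases Nat.lt_or_ge k 3 with h | h
  · interval_cases k <;> norm_num
  · calc 64 ^ k ≤ (3 ^ 4) ^ k := Nat.pow_le_pow_left (by norm_num) k
      _ ≤ (k ^ 4) ^ k := Nat.pow_le_pow_left (Nat.pow_le_pow_left h 4) k
      _ = k ^ (4 * k) := (pow_mul _ _ _).symm
      _ ≤ _ := Nat.le_mul_of_pos_left _ (by norm_num)

theorem time_le (I : Input) (hk : 1 ≤ I.k) (hn : 1 ≤ I.n) :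
    200 + 30 * I.k + 10 * I.q +
      (20 + (I.m + 1) * (20 + (I.q + 1) * (20 + 4 ^ I.k * (20 + 4 ^ I.k *
        (10000 * (I.unit * (I.k + 1)) + 6))))) +
      (40 + 10 * I.k + (I.m + I.q) * (1250 * I.unit + 6)) + (20 + I.m * (40 + I.q * 60)) ≤
    12000 * 8 * 2 * 4096 * (I.n ^ 3 * I.k ^ (4 * I.k + 4)) := by
  set N := I.n + 1 with hN
  set W := 4 ^ I.k with hW
  set K := I.k + 1 with hK
  have hNm : I.m + 1 ≤ N := by simp only [hN, Input.n]; omega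
  have hNq : I.q + 1 ≤ N := by simp only [hN, Input.n]; omega
  have hNn : I.m + I.q ≤ N := by simp only [hN, Input.n]; omega
  have h1N : 1 ≤ N := by omega
  have h1W : 1 ≤ W := Nat.one_le_pow _ _ (by norm_num)
  have h1K : 1 ≤ K := by omega
  have hu : I.unit = N * W := rfl
  -- All terms of the bound are multiples of monomials that divide `Z`.
  set Z := N ^ 3 * W ^ 3 * K with hZ
  have mono : ∀ {x y z : ℕ}, x ≤ 3 → y ≤ 3 → z ≤ 1 → N ^ x * W ^ y * K ^ z ≤ Z := by
    intro x y z hx hy hz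
    calc N ^ x * W ^ y * K ^ z ≤ N ^ 3 * W ^ 3 * K ^ 1 := by gcongr
      _ = Z := by rw [pow_one]
  have m1 : 1 ≤ Z := by simpa using mono (x := 0) (y := 0) (z := 0)
  have m2 : K ≤ Z := by simpa using mono (x := 0) (y := 0) (z := 1)
  have m3 : N ≤ Z := by simpa using mono (x := 1) (y := 0) (z := 0)
  have m4 : N ^ 2 ≤ Z := by simpa using mono (x := 2) (y := 0) (z := 0)
  have m5 : N ^ 2 * W ≤ Z := by simpa using mono (x := 2) (y := 1) (z := 0)
  have m6 : N ^ 2 * W ^ 2 ≤ Z := by simpa using mono (x := 2) (y := 2) (z := 0)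
  have f1 : (I.m + 1) * (20 + (I.q + 1) * (20 + W * (20 + W * (10000 * (I.unit * K) + 6)))) ≤
      10066 * Z := by
    calc _ ≤ N * (20 + N * (20 + W * (20 + W * (10000 * (N * W * K) + 6)))) := by
          rw [hu]; gcongr
      _ = 20 * N + 20 * N ^ 2 + 20 * (N ^ 2 * W) + 6 * (N ^ 2 * W ^ 2) + 10000 * Z := by
          rw [hZ]; ring
      _ ≤ _ := by omega
  have f2 : (I.m + I.q) * (1250 * I.unit + 6) ≤ 1256 * Z := by
    calc _ ≤ N * (1250 * (N * W) + 6) := by rw [hu]; gcongr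
      _ = 1250 * (N ^ 2 * W) + 6 * N := by ring
      _ ≤ _ := by omega
  have f3 : I.m * (40 + I.q * 60) ≤ 100 * Z := by
    calc _ ≤ N * (40 + N * 60) := by gcongr <;> omega
      _ = 40 * N + 60 * N ^ 2 := by ring
      _ ≤ _ := by omega
  have hZle : Z ≤ 8 * I.n ^ 3 * (4096 * I.k ^ (4 * I.k)) * (2 * I.k ^ 4) := by
    rw [hZ]
    gcongr
    · calc N ^ 3 ≤ (2 * I.n) ^ 3 := Nat.pow_le_pow_left (by omega) 3
        _ = 8 * I.n ^ 3 := by ring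
    · calc W ^ 3 = 64 ^ I.k := by rw [hW, ← pow_mul, mul_comm, pow_mul]; norm_num
        _ ≤ _ := sixtyfour_pow_le hk
    · have : I.k ≤ I.k ^ 4 := Nat.le_self_pow (by norm_num) _
      omega
  calc _ ≤ 12000 * Z := by omega
    _ ≤ 12000 * (8 * I.n ^ 3 * (4096 * I.k ^ (4 * I.k)) * (2 * I.k ^ 4)) := by gcongr
    _ = _ := by rw [pow_add]; ring

end ChainAddition

theorem mainTheorem6 :
    ∃ (P : RAM.Cmd) (C : ℕ), ∀ I : ChainAddition.Input, 1 ≤ I.k → 1 ≤ I.n →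
      ∃ (t : ℕ) (M : RAM.Mem), RAM.Runs P I.mem t M ∧
        t ≤ C * (I.n ^ 3 * I.k ^ (4 * I.k + 4)) ∧
        ChainAddition.Solved I M :=
  ⟨ChainAddition.solveC, 12000 * 8 * 2 * 4096, fun I hk hn =>
    (ChainAddition.solveC_spec I).mono (fun _ _ h => h) (ChainAddition.time_le I hk hn)⟩
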